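/- Let $P$ be a probability law of a pair $(X,Y)\in\mathbb R^d\times\mathbb R$ with finite second moments and invertible Gram matrix $\Sigma=\mathbb E[XX^\top]$. Let $\beta=\arg\min_{\theta\in\mathbb R^d}\mathbb E[(Y-\theta^\top X)^2]$ be the projection parameter and $V=\mathrm{Var}[X(Y-X^\top\beta)]$. Let $(X_1,Y_1),\dots,(X_n,Y_n)$ be i.i.d. with law $P$, and let $\hat\beta$ be a least squares estimator, i.e. a minimizer of $\theta\mapsto n^{-1}\sum_{i=1}^n(Y_i-\theta^\top X_i)^2$. For $m,k>0$ write $q_{m,k}=(m/q_x+k/q)^{-1}$ and let $a_+=\max\{a,0\}$. Let $q_x\ge 4$ and $q\ge 2$ satisfy $(1/q_x+1/q)^{-1}>2$, and let $K_x\ge1$, $K_y>0$, $\underline\lambda>0$. There is a constant $C=C(q_x,q,K_x,K_y,\underline\lambda)>0$ such that the following holds for all $n$, $d$, all $\overline\lambda\in[\underline\lambda,\infty)$ and all $P$ as above with $$\left(\mathbb E|Y-X^\top\beta|^q\right)^{1/q}\le K_y,\qquad \left(\mathbb E|u^\top\Sigma^{-1/2}X|^{q_x}\right)^{1/q_x}\le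 K_x\ \text{ for all } u\in\mathbb R^d \text{ with } \|u\|_2=1,$$ $$\underline\lambda\le\lambda_{\min}(\Sigma^{-1/2}V\Sigma^{-1/2})\le\lambda_{\max}(\Sigma^{-1/2}V\Sigma^{-1/2})\le\overline\lambda .$$ For all $\delta_0,\delta_1,\delta_2>0$, with probability at least $1-\delta_0-\delta_1-\delta_2$, $$\max_{1\le i\le n}|X_i^\top(\hat\beta-\beta)|\le C\left(1-9K_x^2\sqrt{\frac{d+2\log(2n/\delta_0)}{n}}\right)_+^{-1}\left\{\sqrt{\frac{d+\log(2n/\delta_1)}{\delta_1^{2/q_x}n^{1-2/q_x}}}+\frac{\sqrt d}{\delta_1^{1/q_{2,1}}n^{1-1/q_{3,2}}}+\frac{d}{\delta_2^{1/q_{2,1}}n^{1-1/q_{2,1}}}\right\},$$ where the right-hand side is read as $+\infty$ (no claim is made) when the positive part is $0$. -/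

import Mathlib

open MeasureTheory ProbabilityTheory
open scoped Matrix MatrixOrder

noncomputable section

namespace LinReg

variable {d n : ℕ}

/-- The population Gram matrix `Σ = E[X Xᵀ]` of the law `P` of a pair `(X, Y)`. -/
def gram (P : Measure ((Fin d → ℝ) × ℝ)) : Matrix (Fin d) (Fin d) ℝ :=
  Matrix.of fun a b => ∫ z, z.1 a * z.1 b ∂P

/-- `Σ^{-1/2}`: the inverse of the positive semidefinite square root of the Gram matrix. -/
def invSqrtGram (P : Measure ((Fin d → ℝ) × ℝ)) : Matrix (Fin d) (Fin d) ℝ :=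
  (CFC.sqrt (gram P))⁻¹

/-- `β` is the projection parameter: it minimizes `θ ↦ E[(Y - θᵀX)²]`. -/
def IsProjectionParameter (P : Measure ((Fin d → ℝ) × ℝ)) (β : Fin d → ℝ) : Prop :=
  ∀ θ : Fin d → ℝ, ∫ z, (z.2 - β ⬝ᵥ z.1) ^ 2 ∂P ≤ ∫ z, (z.2 - θ ⬝ᵥ z.1) ^ 2 ∂P

/-- `b` is a least squares estimate for the data `(x i, y i)`: it minimizes
`θ ↦ (1/n) ∑ᵢ (yᵢ - θᵀxᵢ)²`. -/
def IsLeastSquares (x : Fin n → Fin d → ℝ) (y : Fin n → ℝ) (b : Fin d → ℝ) : Prop :=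
  ∀ θ : Fin d → ℝ,
    (1 / (n : ℝ)) * ∑ i, (y i - b ⬝ᵥ x i) ^ 2 ≤ (1 / (n : ℝ)) * ∑ i, (y i - θ ⬝ᵥ x i) ^ 2

/-- `V = Var[X (Y - Xᵀβ)]`, a `d × d` covariance matrix. -/
def scoreCov (P : Measure ((Fin d → ℝ) × ℝ)) (β : Fin d → ℝ) : Matrix (Fin d) (Fin d) ℝ :=
  Matrix.of fun a b =>
    cov[fun z => z.1 a * (z.2 - z.1 ⬝ᵥ β), fun z => z.1 b * (z.2 - z.1 ⬝ᵥ β); P]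

/-- The standing setting: `P` is a probability law on `ℝᵈ × ℝ` with finite second moments and
invertible Gram matrix. -/
structure IsRegressionLaw (P : Measure ((Fin d → ℝ) × ℝ)) : Prop where
  isProbabilityMeasure : IsProbabilityMeasure P
  memLp_covariate : ∀ a, MemLp (fun z : (Fin d → ℝ) × ℝ => z.1 a) 2 P
  memLp_response : MemLp (fun z : (Fin d → ℝ) × ℝ => z.2) 2 P
  isUnit_gram : IsUnit (gram P)

/-- Error moments: `(E|Y - Xᵀβ|^q)^{1/q} ≤ K_y`. -/
def ErrorMoment (P : Measure ((Fin d → ℝ) × ℝ)) (β : Fin d → ℝ) (q Ky : ℝ) : Prop :=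
  eLpNorm (fun z => z.2 - z.1 ⬝ᵥ β) (ENNReal.ofReal q) P ≤ ENNReal.ofReal Ky

/-- Covariate moments: `(E|uᵀ Σ^{-1/2} X|^{q_x})^{1/q_x} ≤ K_x` for every `u` in the Euclidean
unit sphere. -/
def CovariateMoment (P : Measure ((Fin d → ℝ) × ℝ)) (qx Kx : ℝ) : Prop :=
  ∀ u : Fin d → ℝ, u ⬝ᵥ u = 1 →
    eLpNorm (fun z => u ⬝ᵥ (invSqrtGram P *ᵥ z.1)) (ENNReal.ofReal qx) P ≤ ENNReal.ofReal Kx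

/-- All eigenvalues of the symmetric matrix `Σ^{-1/2} V Σ^{-1/2}` lie in `[lo, hi]`. -/
def ScoreEigenvalueBounds (P : Measure ((Fin d → ℝ) × ℝ)) (β : Fin d → ℝ) (lo hi : ℝ) : Prop :=
  spectrum ℝ (invSqrtGram P * scoreCov P β * invSqrtGram P) ⊆ Set.Icc lo hi

/-- `q_{m,k} = (m / q_x + k / q)⁻¹`. -/
def harm (qx q m k : ℝ) : ℝ := (m / qx + k / q)⁻¹

/-- `1 - 9 K_x² √((d + 2 log (2n/δ₀)) / n)`. -/
def gramFactor (n d : ℕ) (Kx δ₀ : ℝ) : ℝ :=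
  1 - 9 * Kx ^ 2 * Real.sqrt ((d + 2 * Real.log (2 * n / δ₀)) / n)

/-- The sum of the three error terms in the bound. -/
def rate (n d : ℕ) (qx q δ₁ δ₂ : ℝ) : ℝ :=
  Real.sqrt ((d + Real.log (2 * n / δ₁)) / (δ₁ ^ (2 / qx) * (n : ℝ) ^ (1 - 2 / qx)))
    + Real.sqrt d / (δ₁ ^ (1 / harm qx q 2 1) * (n : ℝ) ^ (1 - 1 / harm qx q 3 2))
    + d / (δ₂ ^ (1 / harm qx q 2 1) * (n : ℝ) ^ (1 - 1 / harm qx q 2 1))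

end LinReg

end

namespace LinReg

/-! ### A Rosenthal inequality for sums of i.i.d. vectors -/

/-! Whiten the model: $w=\Sigma^{-1/2}X$, $e=Y-X^\top\beta$, $\theta=\Sigma^{1/2}(\hat\beta-\beta)$.
Then $X_i^\top(\hat\beta-\beta)=w_i\cdot\theta$, and least squares says $\sum_j
(e_j-w_j\cdot\theta)w_j=0$. Let $A_{-i}$ and $S_{-i}$ be the sums of $w_jw_j^\top$ and $e_jw_j$ over
$j\ne i$, and put $\theta_{-i}=A_{-i}^{-1}S_{-i}$. If $A_{-i}\ge n/4$, solving the normal equations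
for the fit at $i$ gives $|w_i\cdot\theta|\le|\theta_{-i}\cdot w_i|+(4/n)\|w_i\|^2|e_i|$
(`abs_fitted_le`).

The gain is independence: $\theta_{-i}$ does not involve $w_i$, so conditionally $\theta_{-i}\cdot
w_i$ is a projection in a fixed direction. Its $q_x$-th moment is at most
$(K_x\|\theta_{-i}\|)^{q_x}$, with no dimension factor from $w_i$, and
$\|\theta_{-i}\|\le(4/n)\|S_{-i}\|$. Markov's inequality and a union over $i$ cost a factor
$(2n/\delta_1)^{1/q_x}$.

Two probabilistic inputs remain. The moment of $\|S_{-i}\|$ comes from a Rosenthal inequality in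
Hilbert space applied to truncated scores (`exists_integral_norm_sum_rpow_le`,
`exists_integral_truncNorm_sum_le`); its Gaussian and heavy-tail parts produce the first two terms
of the rate. The bound $A_{-i}\ge n/4$ needs only fourth moments, since $-(u\cdot w)^2$ is bounded
above and a one-sided exponential moment exists; a weighted union over a grid with a rounding
argument makes it uniform in the direction (`FourthMoment.measure_sum_dotProduct_sq_lt_le`). The
third term is Markov's inequality for $\|w_i\|^2|e_i|$. The budget is $\delta_0$ for the Gram
matrices, $\delta_1$ for scores and fits, $\delta_2$ for leverages. -/

theorem one_add_rpow_le {r t : ℝ} (hr : 2 ≤ r) (ht : -1 ≤ t) (ht' : t ≤ 3) :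
    (1 + t) ^ r ≤ 1 + r * t + r * (r - 1) * 4 ^ (r - 2) * t ^ 2 := by
  have h4 : (1 : ℝ) ≤ 4 ^ (r - 2) := Real.one_le_rpow (by norm_num) (by linarith)
  -- the tangent line at `1 + t` lies below the graph at `1`
  have tangent : ∀ a : ℝ, 1 ≤ a → 0 < 1 + t → (1 + t) ^ a - 1 ≤ a * t * (1 + t) ^ (a - 1) := by
    intro a ha h0
    have hb := one_add_mul_self_le_rpow_one_add (s := -t / (1 + t)) (p := a)
      (by rw [le_div_iff₀ h0]; linarith) ha
    have e : 1 + -t / (1 + t) = (1 + t)⁻¹ := by field_simp; ring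
    rw [e, Real.inv_rpow h0.le] at hb
    have hp : 0 < (1 + t) ^ a := Real.rpow_pos_of_pos h0 a
    have := mul_le_mul_of_nonneg_left hb hp.le
    rw [mul_inv_cancel₀ hp.ne'] at this
    rw [Real.rpow_sub_one h0.ne']
    have e2 : (1 + t) ^ a * (1 + a * (-t / (1 + t))) = (1 + t) ^ a - a * t * ((1 + t) ^ a / (1 + t)) := by
      field_simp; ring
    linarith
  rcases ht.eq_or_lt with rfl | ht
  · norm_num
    rw [Real.zero_rpow (by linarith)]
    nlinarith [mul_nonneg (by linarith : 0 ≤ r) (by linarith : 0 ≤ r - 1), sq_nonneg (r - 2)]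
  have h0 : 0 < 1 + t := by linarith
  have h1 := tangent r (by linarith) h0
  -- `h1` gives $(1+t)^r-1\le rt+rt((1+t)^{r-1}-1)$. The last product is quadratic in $t$: by the
  -- tangent inequality again when $t\ge0$, by Bernoulli's inequality when $t\le0$.
  have h2 : t * ((1 + t) ^ (r - 1) - 1) ≤ (r - 1) * 4 ^ (r - 2) * t ^ 2 := by
    rcases le_total 0 t with hpos | hneg
    · have h3 := tangent (r - 1) (by linarith) h0
      have h4' : (1 + t) ^ (r - 1 - 1) ≤ 4 ^ (r - 2) := by
        rw [show r - 1 - 1 = r - 2 by ring]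
        exact Real.rpow_le_rpow h0.le (by linarith) (by linarith)
      calc t * ((1 + t) ^ (r - 1) - 1) ≤ t * ((r - 1) * t * (1 + t) ^ (r - 1 - 1)) := by gcongr
        _ ≤ t * ((r - 1) * t * 4 ^ (r - 2)) := by
          have : 0 ≤ r - 1 := by linarith
          gcongr
        _ = _ := by ring
    · have h3 := one_add_mul_self_le_rpow_one_add ht.le (p := r - 1) (by linarith)
      calc t * ((1 + t) ^ (r - 1) - 1) ≤ t * ((r - 1) * t) :=
            mul_le_mul_of_nonpos_left (by linarith) hneg
        _ = (r - 1) * 1 * t ^ 2 := by ring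
        _ ≤ _ := by
          have : 0 ≤ r - 1 := by linarith
          gcongr
  have : r * (t * ((1 + t) ^ (r - 1) - 1)) ≤ r * ((r - 1) * 4 ^ (r - 2) * t ^ 2) := by gcongr
  nlinarith

/-- Second order upper bound for the function `‖·‖ ^ p`. -/
theorem exists_norm_add_rpow_le {p : ℝ} (hp : 4 ≤ p) : ∃ C : ℝ, 1 ≤ C ∧
    ∀ {F : Type*} [NormedAddCommGroup F] [InnerProductSpace ℝ F] (x z : F),
      ‖x + z‖ ^ p ≤ ‖x‖ ^ p + p * ‖x‖ ^ (p - 2) * inner ℝ x z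
        + C * (‖x‖ ^ (p - 2) * ‖z‖ ^ 2 + ‖z‖ ^ p) := by
  have hK0 : 0 ≤ p / 2 * (p / 2 - 1) * 4 ^ (p / 2 - 2) := by
    have : 0 ≤ p / 2 - 1 := by linarith
    positivity
  set K := p / 2 * (p / 2 - 1) * 4 ^ (p / 2 - 2) with hK
  have h2p : (0 : ℝ) < 2 ^ p := by positivity
  refine ⟨p + 9 * K + 2 ^ p, by linarith, ?_⟩
  intro F _ _ x z
  have hcs : |inner ℝ x z| ≤ ‖x‖ * ‖z‖ := abs_real_inner_le_norm x z
  have hx0 := norm_nonneg x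
  have hz0 := norm_nonneg z
  have hxp : 0 ≤ ‖x‖ ^ (p - 2) := by positivity
  have hzp : 0 ≤ ‖z‖ ^ p := by positivity
  -- When $\|x\|<\|z\|$ every term is at most a multiple of $\|z\|^p$: the summand $2^p$ of the
  -- constant pays for the left side and $p$ for a negative linear term. Otherwise there is a
  -- genuine second order expansion, whose remainder costs $p/2+9K$.
  rcases lt_or_ge ‖x‖ ‖z‖ with hlt | hle
  · have hz : 0 < ‖z‖ := hx0.trans_lt hlt
    have h1 : ‖x + z‖ ^ p ≤ 2 ^ p * ‖z‖ ^ p := by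
      rw [← Real.mul_rpow (by norm_num) hz0]
      exact Real.rpow_le_rpow (norm_nonneg _) ((norm_add_le x z).trans (by linarith)) (by linarith)
    have h2 : ‖x‖ ^ (p - 2) * |inner ℝ x z| ≤ ‖z‖ ^ p := by
      calc ‖x‖ ^ (p - 2) * |inner ℝ x z| ≤ ‖z‖ ^ (p - 2) * (‖z‖ * ‖z‖) := by
            gcongr
            · linarith
            · exact hcs.trans (by gcongr)
        _ = ‖z‖ ^ p := by
            rw [← sq, ← Real.rpow_natCast, ← Real.rpow_add hz]; norm_num
    have h3 : -(p * ‖z‖ ^ p) ≤ p * ‖x‖ ^ (p - 2) * inner ℝ x z := by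
      have := neg_abs_le (inner ℝ x z)
      have h4 : p * (‖x‖ ^ (p - 2) * -|inner ℝ x z|) ≤ p * (‖x‖ ^ (p - 2) * inner ℝ x z) := by
        gcongr
      nlinarith
    have h5 : 0 ≤ ‖x‖ ^ p := by positivity
    have h6 : 0 ≤ (p + 9 * K + 2 ^ p) * (‖x‖ ^ (p - 2) * ‖z‖ ^ 2) := by positivity
    nlinarith [mul_nonneg hK0 hzp]
  · rcases hx0.eq_or_lt with h | hx
    · have hz : z = 0 := by rw [← norm_eq_zero]; linarith
      have hx : x = 0 := by rw [← norm_eq_zero]; exact h.symm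
      subst hz hx
      simp [Real.zero_rpow (by linarith : p ≠ 0)]
    -- The relative increment of $\|\cdot\|^2$. It lies in $[-1,3]$ because $\|z\|\le\|x\|$, and
    -- $\|\cdot\|^p$ is the power $p/2\ge2$ of the square.
    set t := (2 * inner ℝ x z + ‖z‖ ^ 2) / ‖x‖ ^ 2 with ht
    have hsq : ‖x + z‖ ^ 2 = ‖x‖ ^ 2 * (1 + t) := by
      rw [norm_add_sq_real, ht]; field_simp; ring
    have htx : ‖x‖ ^ 2 * t = 2 * inner ℝ x z + ‖z‖ ^ 2 := by rw [ht]; field_simp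
    have hx2 : 0 < ‖x‖ ^ 2 := by positivity
    have hup := le_abs_self (inner ℝ x z)
    have ht1 : -1 ≤ t := by
      have : 0 ≤ ‖x‖ ^ 2 * (1 + t) := hsq ▸ sq_nonneg _
      have := nonneg_of_mul_nonneg_right this hx2
      linarith
    have ht3 : t ≤ 3 := by
      rw [ht, div_le_iff₀ hx2]; nlinarith
    have key := one_add_rpow_le (r := p / 2) (by linarith) ht1 ht3
    rw [← hK] at key
    have hpow : ∀ y : ℝ, 0 ≤ y → y ^ p = (y ^ 2) ^ (p / 2) := by
      intro y hy
      rw [← Real.rpow_natCast, ← Real.rpow_mul hy]; congr 1; push_cast; ring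
    have hsplit : ‖x‖ ^ p = ‖x‖ ^ (p - 2) * ‖x‖ ^ 2 := by
      rw [← Real.rpow_natCast ‖x‖ 2, ← Real.rpow_add hx]; norm_num
    have ht2 : ‖x‖ ^ 2 * t ^ 2 ≤ 9 * ‖z‖ ^ 2 := by
      have h1 : |‖x‖ ^ 2 * t| ≤ 3 * (‖x‖ * ‖z‖) := by
        rw [htx]
        refine (abs_add_le _ _).trans ?_
        rw [abs_mul, abs_of_nonneg (sq_nonneg ‖z‖), abs_two]
        nlinarith
      have h2 : (‖x‖ ^ 2 * t) ^ 2 ≤ (3 * (‖x‖ * ‖z‖)) ^ 2 := by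
        rw [← sq_abs]; gcongr
      have h3 : ‖x‖ ^ 2 * (‖x‖ ^ 2 * t ^ 2) ≤ ‖x‖ ^ 2 * (9 * ‖z‖ ^ 2) := by nlinarith
      exact le_of_mul_le_mul_left h3 hx2
    have h1 : ‖x + z‖ ^ p ≤ ‖x‖ ^ p * (1 + p / 2 * t + K * t ^ 2) := by
      rw [hpow _ (norm_nonneg (x + z)), hsq, Real.mul_rpow hx2.le (by linarith), ← hpow _ hx0]
      gcongr
    have h2 : ‖x‖ ^ p * (1 + p / 2 * t + K * t ^ 2) = ‖x‖ ^ p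
        + ‖x‖ ^ (p - 2) * (p * inner ℝ x z + p / 2 * ‖z‖ ^ 2 + K * (‖x‖ ^ 2 * t ^ 2)) := by
      calc _ = ‖x‖ ^ p + ‖x‖ ^ (p - 2) * (p / 2 * (‖x‖ ^ 2 * t) + K * (‖x‖ ^ 2 * t ^ 2)) := by
            rw [hsplit]; ring
        _ = _ := by rw [htx]; ring
    have h3 : ‖x‖ ^ (p - 2) * (p * inner ℝ x z + p / 2 * ‖z‖ ^ 2 + K * (‖x‖ ^ 2 * t ^ 2)) ≤
        ‖x‖ ^ (p - 2) * (p * inner ℝ x z + p / 2 * ‖z‖ ^ 2 + K * (9 * ‖z‖ ^ 2)) := by gcongr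
    have h4 : 0 ≤ ‖x‖ ^ (p - 2) * ‖z‖ ^ 2 := by positivity
    have h5 : 0 ≤ (p + 9 * K + 2 ^ p) * ‖z‖ ^ p := by positivity
    nlinarith [mul_nonneg h2p.le h4]

/-- Interpolation of powers: `s ^ a ≤ D ^ (a - p) s ^ p + D ^ a` for `a ≤ p`. -/
theorem rpow_le_rpow_mul_rpow_add_rpow {s D a p : ℝ} (hs : 0 ≤ s) (hD : 0 < D) (ha : 0 ≤ a)
    (hap : a ≤ p) : s ^ a ≤ D ^ (a - p) * s ^ p + D ^ a := by
  rcases le_total s D with h | h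
  · have := Real.rpow_le_rpow hs h ha
    have : 0 ≤ D ^ (a - p) * s ^ p := by positivity
    linarith
  · have hs' : 0 < s := hD.trans_le h
    have h1 : s ^ a = s ^ (a - p) * s ^ p := by rw [← Real.rpow_add hs']; congr 1; ring
    have h2 : s ^ (a - p) ≤ D ^ (a - p) := Real.rpow_le_rpow_of_nonpos hD h (by linarith)
    have : s ^ (a - p) * s ^ p ≤ D ^ (a - p) * s ^ p := by gcongr
    have : 0 ≤ D ^ a := by positivity
    linarith

variable {E : Type*} [MeasurableSpace E]

theorem integrable_of_bounded {μ : Measure E} [IsFiniteMeasure μ] {f : E → ℝ} (hf : Measurable f)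
    {B : ℝ} (hB : ∀ x, |f x| ≤ B) : Integrable f μ :=
  Integrable.of_bound hf.aestronglyMeasurable B (ae_of_all _ hB)

/-- Splitting off the coordinate `i` of a product integral. -/
theorem integral_pi_succAbove {N : ℕ} (P : Measure E) [IsProbabilityMeasure P] (i : Fin (N + 1))
    (f : E × (Fin N → E) → ℝ) :
    ∫ z, f (z i, fun j => z (i.succAbove j)) ∂(Measure.pi fun _ : Fin (N + 1) => P) =
      ∫ y, f y ∂(P.prod (Measure.pi fun _ : Fin N => P)) :=
  (measurePreserving_piFinSuccAbove (fun _ : Fin (N + 1) => P) i).integral_comp' f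

/-- Rosenthal's inequality, for bounded centered i.i.d. vectors in a Hilbert space. -/
theorem exists_integral_norm_sum_rpow_le {p : ℝ} (hp : 4 ≤ p) : ∃ C : ℝ, 1 ≤ C ∧
    ∀ {F : Type*} [NormedAddCommGroup F] [InnerProductSpace ℝ F] [MeasurableSpace F] [BorelSpace F]
      [SecondCountableTopology F] {E : Type*} [MeasurableSpace E]
      (P : Measure E) [IsProbabilityMeasure P] (g : E → F) (_ : Measurable g) (B : ℝ)
      (_ : ∀ x, ‖g x‖ ≤ B) (_ : ∀ u, ∫ x, inner ℝ u (g x) ∂P = 0) (n D : ℝ) (_ : 0 < n)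
      (_ : 0 < D) (_ : C * n * ∫ x, ‖g x‖ ^ 2 ∂P ≤ D ^ 2) (_ : C * n * ∫ x, ‖g x‖ ^ p ∂P ≤ D ^ p)
      (N : ℕ) (_ : (N : ℝ) ≤ n),
      ∫ z, ‖∑ j, g (z j)‖ ^ p ∂(Measure.pi fun _ : Fin N => P) ≤ N / n * D ^ p := by
  obtain ⟨C, hC1, hC⟩ := exists_norm_add_rpow_le hp
  refine ⟨4 * C, by linarith, ?_⟩
  intro F _ _ _ _ _ E _ P _ g hg B hB hmean n D hn hD hvar hmom N
  -- The bound is linear in $N$, so each new summand may add $D^p/n$. Since $N\le n$, the inductive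
  -- hypothesis also keeps the $p$-th moment below $D^p$, which controls the moment of order $p-2$
  -- in the expansion.
  induction N with
  | zero => intro _; simp [Real.zero_rpow (by linarith : p ≠ 0)]
  | succ N ih =>
    intro hN
    push_cast at hN
    have ih := ih (by linarith)
    set π := Measure.pi fun _ : Fin N => P
    set S : (Fin N → E) → F := fun z => ∑ j, g (z j) with hS
    have hSm : Measurable S := by
      refine Finset.measurable_sum _ fun j _ => hg.comp (measurable_pi_apply j)
    have hSB : ∀ z, ‖S z‖ ≤ N * B := fun z => by
      refine (norm_sum_le _ _).trans ?_
      simpa using Finset.sum_le_sum fun j (_ : j ∈ Finset.univ) => hB (z j)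
    have hB0 : 0 ≤ B := by
      have := nonempty_of_isProbabilityMeasure P
      exact (norm_nonneg _).trans (hB (Classical.arbitrary E))
    have e1 : ∫ z, ‖∑ j, g (z j)‖ ^ p ∂(Measure.pi fun _ : Fin (N + 1) => P)
        = ∫ y : E × (Fin N → E), ‖S y.2 + g y.1‖ ^ p ∂(P.prod π) := by
      rw [← integral_pi_succAbove P 0]
      refine integral_congr_ae (ae_of_all _ fun z => ?_)
      simp only [hS]
      rw [Fin.sum_univ_succAbove _ 0, add_comm]
    -- integrability of every term
    have bint : ∀ a : ℝ, 0 ≤ a → Integrable (fun z => ‖S z‖ ^ a) π := fun a ha =>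
      integrable_of_bounded (by fun_prop) (B := (N * B) ^ a) fun z => by
        rw [abs_of_nonneg (by positivity)]
        exact Real.rpow_le_rpow (norm_nonneg _) (hSB z) ha
    have gint : ∀ a : ℝ, 0 ≤ a → Integrable (fun x => ‖g x‖ ^ a) P := fun a ha =>
      integrable_of_bounded (by fun_prop) (B := B ^ a) fun z => by
        rw [abs_of_nonneg (by positivity)]
        exact Real.rpow_le_rpow (norm_nonneg _) (hB z) ha
    have gint2 : Integrable (fun x => ‖g x‖ ^ 2) P := by
      simpa using gint 2 (by norm_num)
    have iA : Integrable (fun y : E × (Fin N → E) => ‖S y.2‖ ^ p) (P.prod π) :=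
      (bint p (by linarith)).comp_snd P
    have iD : Integrable (fun y : E × (Fin N → E) => ‖g y.1‖ ^ p) (P.prod π) :=
      (gint p (by linarith)).comp_fst π
    have iC : Integrable (fun y : E × (Fin N → E) => ‖S y.2‖ ^ (p - 2) * ‖g y.1‖ ^ 2) (P.prod π) := by
      have := gint2.mul_prod (bint (p - 2) (by linarith))
      refine this.congr (ae_of_all _ fun y => ?_)
      simp [mul_comm]
    have iB : Integrable (fun y : E × (Fin N → E) =>
        p * ‖S y.2‖ ^ (p - 2) * inner ℝ (S y.2) (g y.1)) (P.prod π) := by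
      refine integrable_of_bounded (by fun_prop) (B := p * (N * B) ^ (p - 2) * (N * B * B)) ?_
      intro y
      rw [abs_mul, abs_of_nonneg (by positivity : 0 ≤ p * ‖S y.2‖ ^ (p - 2))]
      gcongr
      · linarith
      · exact hSB _
      · exact (abs_real_inner_le_norm _ _).trans
          (mul_le_mul (hSB _) (hB _) (norm_nonneg _) (by positivity))
    -- The new summand is centered and independent of `S`: integrating it first kills the linear
    -- term.
    have e2 : ∫ y : E × (Fin N → E), p * ‖S y.2‖ ^ (p - 2) * inner ℝ (S y.2) (g y.1) ∂(P.prod π)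
        = 0 := by
      rw [integral_prod_symm _ iB]
      simp [integral_const_mul, hmean]
    have e3 : ∫ y : E × (Fin N → E), ‖S y.2‖ ^ (p - 2) * ‖g y.1‖ ^ 2 ∂(P.prod π)
        = (∫ z, ‖S z‖ ^ (p - 2) ∂π) * ∫ x, ‖g x‖ ^ 2 ∂P := by
      rw [mul_comm, ← integral_prod_mul]
      simp [mul_comm]
    have e4 : ∫ y : E × (Fin N → E), ‖S y.2‖ ^ p ∂(P.prod π) = ∫ z, ‖S z‖ ^ p ∂π := by
      simpa using integral_prod_mul (μ := P) (ν := π) (fun _ => (1 : ℝ)) (fun z => ‖S z‖ ^ p)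
    have e5 : ∫ y : E × (Fin N → E), ‖g y.1‖ ^ p ∂(P.prod π) = ∫ x, ‖g x‖ ^ p ∂P := by
      simpa using integral_prod_mul (μ := P) (ν := π) (fun x => ‖g x‖ ^ p) (fun _ => (1 : ℝ))
    have step : ∫ y : E × (Fin N → E), ‖S y.2 + g y.1‖ ^ p ∂(P.prod π) ≤
        ∫ z, ‖S z‖ ^ p ∂π
          + C * ((∫ z, ‖S z‖ ^ (p - 2) ∂π) * (∫ x, ‖g x‖ ^ 2 ∂P) + ∫ x, ‖g x‖ ^ p ∂P) := by
      calc _ ≤ ∫ y : E × (Fin N → E), (‖S y.2‖ ^ p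
              + p * ‖S y.2‖ ^ (p - 2) * inner ℝ (S y.2) (g y.1)
              + C * (‖S y.2‖ ^ (p - 2) * ‖g y.1‖ ^ 2 + ‖g y.1‖ ^ p)) ∂(P.prod π) := by
            refine integral_mono_of_nonneg (ae_of_all _ fun y => by positivity) ?_
              (ae_of_all _ fun y => hC _ _)
            exact (iA.add iB).add ((iC.add iD).const_mul C)
        _ = _ := by
            rw [integral_add (by exact iA.add iB) (by exact (iC.add iD).const_mul C),
              integral_add iA iB, integral_const_mul, integral_add iC iD, e2, e3, e4, e5, add_zero]
    have hinter : ∫ z, ‖S z‖ ^ (p - 2) ∂π ≤ 2 * D ^ (p - 2) := by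
      have hND : (N : ℝ) / n * D ^ p ≤ D ^ p := by
        have : (N : ℝ) / n ≤ 1 := by rw [div_le_one hn]; linarith
        have h0 : 0 ≤ D ^ p := by positivity
        nlinarith
      calc ∫ z, ‖S z‖ ^ (p - 2) ∂π ≤ ∫ z, (D ^ (p - 2 - p) * ‖S z‖ ^ p + D ^ (p - 2)) ∂π := by
            refine integral_mono (bint _ (by linarith))
              (((bint p (by linarith)).const_mul _).add (integrable_const _)) fun z => ?_
            exact rpow_le_rpow_mul_rpow_add_rpow (norm_nonneg _) hD (by linarith) (by linarith)
        _ = D ^ (p - 2 - p) * ∫ z, ‖S z‖ ^ p ∂π + D ^ (p - 2) := by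
            rw [integral_add ((bint p (by linarith)).const_mul _) (integrable_const _),
              integral_const_mul]
            simp
        _ ≤ D ^ (p - 2 - p) * D ^ p + D ^ (p - 2) := by gcongr; exact ih.trans hND
        _ = 2 * D ^ (p - 2) := by rw [← Real.rpow_add hD]; ring_nf
    have hv0 : 0 ≤ ∫ x, ‖g x‖ ^ 2 ∂P := integral_nonneg fun _ => by positivity
    have h1 : (∫ z, ‖S z‖ ^ (p - 2) ∂π) * (∫ x, ‖g x‖ ^ 2 ∂P) ≤
        2 * D ^ (p - 2) * ∫ x, ‖g x‖ ^ 2 ∂P := by gcongr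
    have h2 : D ^ (p - 2) * (4 * C * n * ∫ x, ‖g x‖ ^ 2 ∂P) ≤ D ^ p := by
      calc _ ≤ D ^ (p - 2) * D ^ 2 := by gcongr
        _ = D ^ p := by rw [← Real.rpow_natCast D 2, ← Real.rpow_add hD]; norm_num
    rw [e1]
    refine step.trans ?_
    -- With the factor 4 in the constant, the variance term costs at most $D^p/2$ and the $p$-th
    -- moment term at most $D^p/4$, within the allowance $D^p$.
    rw [← mul_le_mul_iff_right₀ hn]
    have e6 : n * (((N + 1 : ℕ) : ℝ) / n * D ^ p) = n * (N / n * D ^ p) + D ^ p := by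
      push_cast; field_simp
    rw [e6]
    have ih' : n * ∫ z, ‖S z‖ ^ p ∂π ≤ n * (N / n * D ^ p) := by gcongr
    have h3 : n * (C * ((∫ z, ‖S z‖ ^ (p - 2) ∂π) * ∫ x, ‖g x‖ ^ 2 ∂P)) ≤
        n * (C * (2 * D ^ (p - 2) * ∫ x, ‖g x‖ ^ 2 ∂P)) := by gcongr
    have h4 : 0 ≤ D ^ p := by positivity
    nlinarith

end LinReg

namespace LinReg

/-! ### A lower bound for empirical Gram matrices under fourth moments -/

/-- Only an upper bound on $u$ is needed, because for $u<-1$ the left side is below 1 and $u+u^2$ is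
positive. This one-sidedness is what makes lower tails of quadratic forms accessible with few
moments. -/
theorem exp_le_one_add_add_sq {u : ℝ} (hu : u ≤ 1) : Real.exp u ≤ 1 + u + u ^ 2 := by
  rcases le_or_gt (-1) u with h | h
  · have := (abs_le.1 (Real.abs_exp_sub_one_sub_id_le (abs_le.2 ⟨h, hu⟩))).2
    linarith
  · have : Real.exp u ≤ 1 := Real.exp_le_one_iff.2 (by linarith)
    nlinarith

/-- Derandomized coordinatewise rounding of a point to a grid. -/
theorem exists_grid_le {d : ℕ} (f : (Fin d → ℝ) → ℝ) (q : Fin d → ℝ) (hq : ∀ a, 0 ≤ q a) {m : ℝ}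
    (hm : 0 < m)
    (hf : ∀ θ a, ∃ l c, c ≤ q a ∧ ∀ y, f (θ + Pi.single a y) = f θ + l * y + c * y ^ 2)
    (v : Fin d → ℝ) :
    ∃ k : Fin d → ℤ, (∀ a, |m * k a - v a| ≤ m) ∧
      f (fun a => m * k a) ≤ f v + m ^ 2 / 4 * ∑ a, q a := by
  -- Induction on the set of coordinates already rounded; the others still agree with `v`.
  suffices h : ∀ s : Finset (Fin d), ∃ θ : Fin d → ℝ, (∀ a ∉ s, θ a = v a) ∧
      (∀ a ∈ s, ∃ k : ℤ, θ a = m * k) ∧ (∀ a, |θ a - v a| ≤ m) ∧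
      f θ ≤ f v + m ^ 2 / 4 * ∑ a ∈ s, q a by
    obtain ⟨θ, -, h1, h2, h3⟩ := h Finset.univ
    choose k hk using fun a => h1 a (Finset.mem_univ a)
    obtain rfl : θ = fun a => m * k a := funext hk
    exact ⟨k, h2, h3⟩
  intro s
  induction s using Finset.induction_on with
  | empty => exact ⟨v, fun _ _ => rfl, by simp, by simp [hm.le], by simp⟩
  | insert a s has ih =>
    obtain ⟨θ, h0, h1, h2, h3⟩ := ih
    obtain ⟨l, c, hc, hfc⟩ := hf θ a
    set r := Int.fract (v a / m) * m with hr
    have hr0 : 0 ≤ r := mul_nonneg (Int.fract_nonneg _) hm.le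
    have hrm : r < m := by
      have := Int.fract_lt_one (v a / m); rw [hr]; nlinarith
    have hfl : v a - r = m * ⌊v a / m⌋ := by
      rw [hr, Int.fract]; field_simp; ring
    -- Unbiased random rounding: move by $-r$ with probability $(m-r)/m$ and by $m-r$ with
    -- probability $r/m$. The mean move is 0, so the linear term drops out, and the variance is
    -- $r(m-r)\le m^2/4$. One of the two moves does at least as well as the mean.
    have hbal : (m - r) * f (θ + Pi.single a (-r)) + r * f (θ + Pi.single a (m - r)) ≤
        m * (f θ + m ^ 2 / 4 * q a) := by
      rw [hfc, hfc]
      have e1 : (m - r) * (f θ + l * -r + c * (-r) ^ 2) + r * (f θ + l * (m - r) + c * (m - r) ^ 2)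
          = m * (f θ + c * (r * (m - r))) := by ring
      rw [e1]
      have h4 : 0 ≤ r * (m - r) := mul_nonneg hr0 (by linarith)
      have h5 : r * (m - r) ≤ m ^ 2 / 4 := by nlinarith [sq_nonneg (m - 2 * r)]
      have h6 : c * (r * (m - r)) ≤ m ^ 2 / 4 * q a := by nlinarith [hq a]
      gcongr
    obtain ⟨y, hy1, hy2, hy3⟩ : ∃ y : ℝ, (∃ k : ℤ, v a + y = m * k) ∧ |y| ≤ m ∧
        f (θ + Pi.single a y) ≤ f θ + m ^ 2 / 4 * q a := by
      by_contra! hcon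
      have c1 := hcon (-r) ⟨_, by rw [← hfl]; ring⟩ (by rw [abs_neg, abs_of_nonneg hr0]; exact hrm.le)
      have c2 := hcon (m - r) ⟨⌊v a / m⌋ + 1, by push_cast; linarith⟩
        (by rw [abs_of_nonneg (by linarith)]; linarith)
      nlinarith
    refine ⟨θ + Pi.single a y, ?_, ?_, ?_, ?_⟩
    · intro b hb
      rw [Finset.mem_insert, not_or] at hb
      simp [hb.1, h0 b hb.2]
    · intro b hb
      rcases eq_or_ne b a with rfl | hba
      · obtain ⟨k, hk⟩ := hy1
        exact ⟨k, by simp [h0 _ has, hk]⟩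
      · obtain ⟨k, hk⟩ := h1 b ((Finset.mem_insert.1 hb).resolve_left hba)
        exact ⟨k, by simp [hba, hk]⟩
    · intro b
      rcases eq_or_ne b a with rfl | hba
      · simpa [h0 _ has] using hy2
      · simpa [hba] using h2 b
    · rw [Finset.sum_insert has]; linarith

/-- Since $k^2\ge|k|$, each term is at most $(4/5)^{|k|}$, and $1+2\sum_{k\ge1}(4/5)^k=9$. The
partial sums of this series are exactly the induction bound $9-8(4/5)^B$. -/
theorem sum_exp_neg_sq_le (B : ℕ) :
    ∑ k ∈ Finset.Icc (-(B : ℤ)) B, Real.exp (-((k : ℝ) ^ 2 / 4)) ≤ 9 := by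
  have h45 : Real.exp (-(1 / 4)) ≤ 4 / 5 := by
    rw [Real.exp_neg]
    refine inv_le_of_inv_le₀ (by norm_num) ?_
    have := Real.add_one_le_exp (1 / 4 : ℝ)
    norm_num at this ⊢; linarith
  have hterm : ∀ B : ℕ, Real.exp (-((B + 1 : ℝ) ^ 2 / 4)) ≤ (4 / 5) ^ (B + 1) := by
    intro B
    calc Real.exp (-((B + 1 : ℝ) ^ 2 / 4)) ≤ Real.exp ((B + 1 : ℕ) * (-(1 / 4))) := by
          gcongr; push_cast; nlinarith [(Nat.cast_nonneg B : (0 : ℝ) ≤ B)]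
      _ = Real.exp (-(1 / 4)) ^ (B + 1) := Real.exp_nat_mul _ _
      _ ≤ _ := by gcongr
  suffices h : ∑ k ∈ Finset.Icc (-(B : ℤ)) B, Real.exp (-((k : ℝ) ^ 2 / 4)) ≤
      9 - 8 * (4 / 5) ^ B by
    have : (0 : ℝ) ≤ (4 / 5) ^ B := by positivity
    linarith
  induction B with
  | zero => norm_num
  | succ B ih =>
    have e : Finset.Icc (-((B + 1 : ℕ) : ℤ)) ((B + 1 : ℕ) : ℤ) =
        insert ((B : ℤ) + 1) (insert (-((B : ℤ) + 1)) (Finset.Icc (-(B : ℤ)) B)) := by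
      ext k; simp only [Finset.mem_Icc, Finset.mem_insert]; push_cast; omega
    rw [e, Finset.sum_insert, Finset.sum_insert]
    · have := hterm B
      push_cast
      rw [neg_sq]
      have e2 : (4 / 5 : ℝ) ^ (B + 1) = (4 / 5) ^ B * (4 / 5) := pow_succ _ _
      linarith
    · simp
    · simp only [Finset.mem_insert, Finset.mem_Icc]; omega

/-- The Gaussian weights $9^{-d}e^{-|k|^2/4}$ have total mass at most 1 whatever the box. A union
bound weighted by them pays $d\log 9+|k|^2/4$ instead of the logarithm of the number of grid points.
-/
theorem sum_exp_neg_dotProduct_le (d B : ℕ) :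
    ∑ k ∈ Fintype.piFinset fun _ : Fin d => Finset.Icc (-(B : ℤ)) B,
      Real.exp (-((∑ a, (k a : ℝ) ^ 2) / 4)) ≤ 9 ^ d := by
  have e : ∀ k : Fin d → ℤ, Real.exp (-((∑ a, (k a : ℝ) ^ 2) / 4)) =
      ∏ a, Real.exp (-((k a : ℝ) ^ 2 / 4)) := by
    intro k
    rw [← Real.exp_sum, Finset.sum_neg_distrib, Finset.sum_div]
  simp_rw [e]
  rw [Finset.sum_prod_piFinset (Finset.Icc (-(B : ℤ)) B) fun _ k => Real.exp (-((k : ℝ) ^ 2 / 4))]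
  calc _ ≤ ∏ _a : Fin d, (9 : ℝ) :=
        Finset.prod_le_prod (fun _ _ => Finset.sum_nonneg fun _ _ => (Real.exp_pos _).le)
          fun _ _ => sum_exp_neg_sq_le B
    _ = 9 ^ d := by simp

/-! ### Truncated isotropic vectors and their exponential moments -/

variable {E : Type*} {d : ℕ}

/-- Truncation of a random vector at squared length `R`. -/
noncomputable def truncSq (R : ℝ) (w : E → Fin d → ℝ) (x : E) : Fin d → ℝ :=
  if w x ⬝ᵥ w x ≤ R then w x else 0

theorem dotProduct_self_nonneg (v : Fin d → ℝ) : 0 ≤ v ⬝ᵥ v :=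
  Finset.sum_nonneg fun _ _ => mul_self_nonneg _

theorem dotProduct_sq_le (u v : Fin d → ℝ) : (u ⬝ᵥ v) ^ 2 ≤ (u ⬝ᵥ u) * (v ⬝ᵥ v) := by
  simpa [dotProduct, sq] using Finset.sum_mul_sq_le_sq_mul_sq Finset.univ u v

theorem truncSq_dotProduct_self_le {R : ℝ} (hR : 0 ≤ R) (w : E → Fin d → ℝ) (x : E) :
    truncSq R w x ⬝ᵥ truncSq R w x ≤ R := by
  unfold truncSq; split_ifs with h
  · exact h
  · simpa using hR

theorem truncSq_dotProduct_self_le_self (R : ℝ) (w : E → Fin d → ℝ) (x : E) :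
    truncSq R w x ⬝ᵥ truncSq R w x ≤ w x ⬝ᵥ w x := by
  unfold truncSq; split_ifs with h
  · exact le_rfl
  · simpa using dotProduct_self_nonneg (w x)

theorem dotProduct_truncSq_sq_le (R : ℝ) (w : E → Fin d → ℝ) (u : Fin d → ℝ) (x : E) :
    (u ⬝ᵥ truncSq R w x) ^ 2 ≤ (u ⬝ᵥ w x) ^ 2 := by
  unfold truncSq; split_ifs with h
  · exact le_rfl
  · simpa using sq_nonneg _

variable [MeasurableSpace E]

@[fun_prop]
theorem measurable_dotProduct {f g : E → Fin d → ℝ} (hf : Measurable f) (hg : Measurable g) :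
    Measurable fun x => f x ⬝ᵥ g x :=
  Finset.measurable_sum _ fun a _ =>
    ((measurable_pi_apply a).comp hf).mul ((measurable_pi_apply a).comp hg)

theorem measurable_truncSq (R : ℝ) {w : E → Fin d → ℝ} (hw : Measurable w) :
    Measurable (truncSq R w) :=
  Measurable.ite (measurableSet_le (by fun_prop) measurable_const) hw measurable_const

/-- Isotropic random vectors with bounded directional fourth moments. -/
structure FourthMoment (P : Measure E) (w : E → Fin d → ℝ) (H : ℝ) : Prop where
  measurable : Measurable w
  isotropic : ∀ u, ∫ x, (u ⬝ᵥ w x) ^ 2 ∂P = u ⬝ᵥ u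
  integrable : ∀ u, Integrable (fun x => (u ⬝ᵥ w x) ^ 4) P
  integral_le : ∀ u, ∫ x, (u ⬝ᵥ w x) ^ 4 ∂P ≤ H * (u ⬝ᵥ u) ^ 2

namespace FourthMoment

variable {P : Measure E} {w : E → Fin d → ℝ} {H : ℝ}

theorem integral_coord_four_le (h : FourthMoment P w H) (a : Fin d) :
    Integrable (fun x => w x a ^ 4) P ∧ ∫ x, w x a ^ 4 ∂P ≤ H := by
  have h1 := h.integrable (Pi.single a 1)
  have h2 := h.integral_le (Pi.single a 1)
  simp only [single_dotProduct, one_mul] at h1 h2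
  exact ⟨h1, by simpa using h2⟩

variable [IsProbabilityMeasure P]

theorem integrable_sq (h : FourthMoment P w H) (u : Fin d → ℝ) :
    Integrable (fun x => (u ⬝ᵥ w x) ^ 2) P := by
  have hm := h.measurable
  refine ((integrable_const (1 : ℝ)).add (h.integrable u)).mono'
    (Measurable.aestronglyMeasurable (by fun_prop)) (ae_of_all _ fun x => ?_)
  rw [Real.norm_of_nonneg (by positivity)]
  simp only [Pi.add_apply]
  nlinarith [sq_nonneg ((u ⬝ᵥ w x) ^ 2 - 1)]

theorem integral_coord_sq (h : FourthMoment P w H) (a : Fin d) :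
    Integrable (fun x => w x a ^ 2) P ∧ ∫ x, w x a ^ 2 ∂P = 1 := by
  have h1 := h.integrable_sq (Pi.single a 1)
  have h2 := h.isotropic (Pi.single a 1)
  simp only [single_dotProduct, one_mul] at h1 h2
  exact ⟨h1, by simpa using h2⟩

theorem integrable_of_bounded_trunc {R : ℝ} (hR : 0 ≤ R) (h : FourthMoment P w H)
    {f : (Fin d → ℝ) → ℝ} (hf : Measurable f) {B : ℝ} (hB : ∀ y, y ⬝ᵥ y ≤ R → |f y| ≤ B) :
    Integrable (fun x => f (truncSq R w x)) P :=
  integrable_of_bounded (hf.comp (measurable_truncSq R h.measurable)) fun x =>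
    hB _ (truncSq_dotProduct_self_le hR w x)

theorem integrable_trunc_dot_pow {R : ℝ} (hR : 0 ≤ R) (h : FourthMoment P w H) (u : Fin d → ℝ)
    (j : ℕ) : Integrable (fun x => ((u ⬝ᵥ truncSq R w x) ^ 2) ^ j) P := by
  refine h.integrable_of_bounded_trunc hR (f := fun y => ((u ⬝ᵥ y) ^ 2) ^ j) (by fun_prop)
    (B := ((u ⬝ᵥ u) * R) ^ j) fun y hy => ?_
  rw [abs_of_nonneg (by positivity)]
  gcongr
  exact (dotProduct_sq_le u y).trans (by gcongr; exact dotProduct_self_nonneg u)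

theorem integrable_trunc_self_pow {R : ℝ} (hR : 0 ≤ R) (h : FourthMoment P w H) (j : ℕ) :
    Integrable (fun x => (truncSq R w x ⬝ᵥ truncSq R w x) ^ j) P := by
  refine h.integrable_of_bounded_trunc hR (f := fun y => (y ⬝ᵥ y) ^ j) (by fun_prop)
    (B := R ^ j) fun y hy => ?_
  have := dotProduct_self_nonneg y
  rw [abs_of_nonneg (by positivity)]
  gcongr

theorem integral_trunc_four_le {R : ℝ} (hR : 0 ≤ R) (h : FourthMoment P w H) (u : Fin d → ℝ) :
    ∫ x, ((u ⬝ᵥ truncSq R w x) ^ 2) ^ 2 ∂P ≤ H * (u ⬝ᵥ u) ^ 2 := by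
  refine (integral_mono (h.integrable_trunc_dot_pow hR u 2) (h.integrable u) fun x => ?_).trans
    (h.integral_le u)
  have := dotProduct_truncSq_sq_le R w u x
  calc ((u ⬝ᵥ truncSq R w x) ^ 2) ^ 2 ≤ ((u ⬝ᵥ w x) ^ 2) ^ 2 := by gcongr
    _ = (u ⬝ᵥ w x) ^ 4 := by ring

theorem integral_trunc_self_le {R : ℝ} (hR : 0 ≤ R) (h : FourthMoment P w H) :
    ∫ x, (truncSq R w x ⬝ᵥ truncSq R w x) ∂P ≤ d := by
  have hi := h.integrable_trunc_self_pow hR 1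
  simp only [pow_one] at hi
  calc _ ≤ ∫ x, ∑ a, w x a ^ 2 ∂P := by
        refine integral_mono hi (integrable_finsetSum _ fun a _ => (h.integral_coord_sq a).1)
          fun x => ?_
        refine (truncSq_dotProduct_self_le_self R w x).trans_eq ?_
        simp [dotProduct, sq]
    _ = d := by
        rw [integral_finsetSum _ fun a _ => (h.integral_coord_sq a).1]
        simp [fun a => (h.integral_coord_sq a).2]

theorem integral_trunc_self_sq_le {R : ℝ} (hR : 0 ≤ R) (h : FourthMoment P w H) :
    ∫ x, (truncSq R w x ⬝ᵥ truncSq R w x) ^ 2 ∂P ≤ H * d ^ 2 := by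
  calc _ ≤ ∫ x, d * ∑ a, w x a ^ 4 ∂P := by
        refine integral_mono (h.integrable_trunc_self_pow hR 2)
          ((integrable_finsetSum _ fun a _ => (h.integral_coord_four_le a).1).const_mul _)
          fun x => ?_
        have h1 := truncSq_dotProduct_self_le_self R w x
        have h2 := dotProduct_self_nonneg (truncSq R w x)
        have h3 := sq_sum_le_card_mul_sum_sq (s := Finset.univ) (f := fun a => w x a ^ 2)
        calc (truncSq R w x ⬝ᵥ truncSq R w x) ^ 2 ≤ (w x ⬝ᵥ w x) ^ 2 := by gcongr
          _ ≤ d * ∑ a, w x a ^ 4 := by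
            simp only [Finset.card_univ, Fintype.card_fin, ← pow_mul] at h3
            simpa [dotProduct, ← sq] using h3
    _ = d * ∑ a, ∫ x, w x a ^ 4 ∂P := by
        rw [integral_const_mul, integral_finsetSum _ fun a _ => (h.integral_coord_four_le a).1]
    _ ≤ d * ∑ _a : Fin d, H := by
        gcongr with a; exact (h.integral_coord_four_le a).2
    _ = H * d ^ 2 := by simp; ring

/-- Truncation loses at most $(u\cdot w)^2\|w\|^2/R$. Splitting $\|w\|^2$ into coordinates, the mean
of $(u\cdot w)^2w_a^2$ is at most $H\,(u\cdot u)$, by a weighted arithmetic-geometric mean and the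
fourth moments. -/
theorem le_integral_trunc_sq {R : ℝ} (hR : 0 < R) (h : FourthMoment P w H) (u : Fin d → ℝ) :
    (1 - H * d / R) * (u ⬝ᵥ u) ≤ ∫ x, (u ⬝ᵥ truncSq R w x) ^ 2 ∂P := by
  have hi : Integrable (fun x => (u ⬝ᵥ truncSq R w x) ^ 2) P := by
    simpa using h.integrable_trunc_dot_pow hR.le u 1
  rcases (dotProduct_self_nonneg u).eq_or_lt with h0 | h0
  · rw [← h0, mul_zero]; exact integral_nonneg fun _ => sq_nonneg _
  set q := u ⬝ᵥ u
  have hterm : ∀ a, Integrable (fun x => ((u ⬝ᵥ w x) ^ 4 / q + q * w x a ^ 4) / 2) P := fun a =>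
    (((h.integrable u).div_const _).add ((h.integral_coord_four_le a).1.const_mul _)).div_const _
  have hpt : ∀ x, (u ⬝ᵥ w x) ^ 2 - (∑ a, ((u ⬝ᵥ w x) ^ 4 / q + q * w x a ^ 4) / 2) / R ≤
      (u ⬝ᵥ truncSq R w x) ^ 2 := by
    intro x
    have hsum : (u ⬝ᵥ w x) ^ 2 * (w x ⬝ᵥ w x) ≤
        ∑ a, ((u ⬝ᵥ w x) ^ 4 / q + q * w x a ^ 4) / 2 := by
      rw [show w x ⬝ᵥ w x = ∑ a, w x a * w x a from rfl, Finset.mul_sum]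
      refine Finset.sum_le_sum fun a _ => ?_
      have e : ((u ⬝ᵥ w x) ^ 4 / q + q * w x a ^ 4) / 2 - (u ⬝ᵥ w x) ^ 2 * (w x a * w x a)
          = ((u ⬝ᵥ w x) ^ 2 - q * w x a ^ 2) ^ 2 / (2 * q) := by
        field_simp; ring
      have : 0 ≤ ((u ⬝ᵥ w x) ^ 2 - q * w x a ^ 2) ^ 2 / (2 * q) := by positivity
      linarith
    have hww := dotProduct_self_nonneg (w x)
    unfold truncSq
    split_ifs with hx
    · have : 0 ≤ (∑ a, ((u ⬝ᵥ w x) ^ 4 / q + q * w x a ^ 4) / 2) / R := by positivity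
      linarith
    · push Not at hx
      have : (u ⬝ᵥ w x) ^ 2 ≤ (∑ a, ((u ⬝ᵥ w x) ^ 4 / q + q * w x a ^ 4) / 2) / R := by
        rw [le_div_iff₀ hR]
        refine le_trans ?_ hsum
        gcongr
      simpa using this
  have hisum := integrable_finsetSum Finset.univ fun a _ => hterm a
  calc (1 - H * d / R) * q ≤ q - (∑ a, ∫ x, ((u ⬝ᵥ w x) ^ 4 / q + q * w x a ^ 4) / 2 ∂P) / R := by
        have : ∀ a, ∫ x, ((u ⬝ᵥ w x) ^ 4 / q + q * w x a ^ 4) / 2 ∂P ≤ H * q := by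
          intro a
          rw [integral_div, integral_add ((h.integrable u).div_const _)
            ((h.integral_coord_four_le a).1.const_mul _), integral_div, integral_const_mul]
          have h1 : (∫ x, (u ⬝ᵥ w x) ^ 4 ∂P) / q ≤ H * q := by
            rw [div_le_iff₀ h0]; nlinarith [h.integral_le u]
          have h2 := mul_le_mul_of_nonneg_left (h.integral_coord_four_le a).2 h0.le
          linarith
        have hs : ∑ a, ∫ x, ((u ⬝ᵥ w x) ^ 4 / q + q * w x a ^ 4) / 2 ∂P ≤ d * (H * q) := by
          refine (Finset.sum_le_sum fun a _ => this a).trans ?_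
          simp
        have hs' : (∑ a, ∫ x, ((u ⬝ᵥ w x) ^ 4 / q + q * w x a ^ 4) / 2 ∂P) / R ≤
            d * (H * q) / R := by gcongr
        have e : d * (H * q) / R = H * d / R * q := by ring
        linarith
    _ = ∫ x, ((u ⬝ᵥ w x) ^ 2 - (∑ a, ((u ⬝ᵥ w x) ^ 4 / q + q * w x a ^ 4) / 2) / R) ∂P := by
        rw [integral_sub (h.integrable_sq u) (hisum.div_const _), h.isotropic, integral_div,
          integral_finsetSum _ fun a _ => hterm a]
    _ ≤ _ := integral_mono ((h.integrable_sq u).sub (hisum.div_const _)) hi hpt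

/-- One-sided exponential moment of a truncated, trace-corrected quadratic form. -/
theorem integral_exp_trunc_le (h : FourthMoment P w H) (hH : 1 ≤ H) (hd : 0 < d)
    (u : Fin d → ℝ) {t R : ℝ} (ht : t = 13 / 100 / H) (hR : R = 100 * H * d) :
    ∫ x, Real.exp (t * (truncSq R w x ⬝ᵥ truncSq R w x / (16 * d) - (u ⬝ᵥ truncSq R w x) ^ 2)) ∂P ≤
      Real.exp (-(99 / 100 * t * (u ⬝ᵥ u)) + t / 16
        + t ^ 2 * H * ((u ⬝ᵥ u) ^ 2 + 1 / 256)) := by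
  have hd' : (0 : ℝ) < d := by exact_mod_cast hd
  have hH0 : 0 < H := by linarith
  have hR0 : 0 < R := by rw [hR]; positivity
  have ht0 : 0 < t := by rw [ht]; positivity
  set y : E → ℝ := fun x => truncSq R w x ⬝ᵥ truncSq R w x with hy
  set s : E → ℝ := fun x => (u ⬝ᵥ truncSq R w x) ^ 2 with hs
  have iy : Integrable y P := by simpa using h.integrable_trunc_self_pow hR0.le 1
  have iy2 : Integrable (fun x => y x ^ 2) P := h.integrable_trunc_self_pow hR0.le 2
  have is : Integrable s P := by simpa using h.integrable_trunc_dot_pow hR0.le u 1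
  have is2 : Integrable (fun x => s x ^ 2) P := h.integrable_trunc_dot_pow hR0.le u 2
  have hy0 : ∀ x, 0 ≤ y x := fun x => dotProduct_self_nonneg _
  have hs0 : ∀ x, 0 ≤ s x := fun x => sq_nonneg _
  have i1 : Integrable (fun x => t * (y x / (16 * d) - s x)) P :=
    ((iy.div_const _).sub is).const_mul t
  have i2 : Integrable (fun x => t ^ 2 * (y x ^ 2 / (16 * d) ^ 2 + s x ^ 2)) P :=
    ((iy2.div_const _).add is2).const_mul _
  have hle : ∀ x, Real.exp (t * (y x / (16 * d) - s x)) ≤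
      1 + t * (y x / (16 * d) - s x) + t ^ 2 * (y x ^ 2 / (16 * d) ^ 2 + s x ^ 2) := by
    intro x
    have hyR : y x ≤ R := truncSq_dotProduct_self_le hR0.le w x
    -- The truncation level serves here: it bounds the positive part of the exponent by
    -- $tR/(16d)=13/16$. The negative part needs no bound.
    have h1 : t * (y x / (16 * d) - s x) ≤ 1 := by
      calc t * (y x / (16 * d) - s x) ≤ t * (R / (16 * d)) := by
            gcongr
            have : y x / (16 * d) ≤ R / (16 * d) := by gcongr
            linarith [hs0 x]
        _ = 13 / 16 := by rw [ht, hR]; field_simp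
        _ ≤ 1 := by norm_num
    refine (exp_le_one_add_add_sq h1).trans ?_
    -- The cross term of the square has a favourable sign and is dropped, so no mixed moment is
    -- needed.
    have h2 : 0 ≤ y x / (16 * d) * s x := mul_nonneg (div_nonneg (hy0 x) (by positivity)) (hs0 x)
    have h3 : (t * (y x / (16 * d) - s x)) ^ 2 = t ^ 2 * (y x ^ 2 / (16 * d) ^ 2 + s x ^ 2)
        - 2 * t ^ 2 * (y x / (16 * d) * s x) := by rw [← div_pow]; ring
    rw [h3]
    have : 0 ≤ 2 * t ^ 2 * (y x / (16 * d) * s x) := by positivity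
    linarith
  calc _ ≤ ∫ x, (1 + t * (y x / (16 * d) - s x)
            + t ^ 2 * (y x ^ 2 / (16 * d) ^ 2 + s x ^ 2)) ∂P :=
        integral_mono_of_nonneg (ae_of_all _ fun _ => (Real.exp_pos _).le)
          (((integrable_const 1).add i1).add i2) (ae_of_all _ hle)
    _ = 1 + t * ((∫ x, y x ∂P) / (16 * d) - ∫ x, s x ∂P)
          + t ^ 2 * ((∫ x, y x ^ 2 ∂P) / (16 * d) ^ 2 + ∫ x, s x ^ 2 ∂P) := by
        rw [integral_add (by exact (integrable_const 1).add i1) i2,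
          integral_add (integrable_const 1) i1, integral_const_mul, integral_const_mul,
          integral_sub (iy.div_const _) is, integral_add (iy2.div_const _) is2, integral_div,
          integral_div]
        simp
    _ ≤ 1 + t * (d / (16 * d) - 99 / 100 * (u ⬝ᵥ u))
          + t ^ 2 * (H * d ^ 2 / (16 * d) ^ 2 + H * (u ⬝ᵥ u) ^ 2) := by
        have h1 := h.integral_trunc_self_le hR0.le
        have h2 := h.le_integral_trunc_sq hR0 u
        have h3 := h.integral_trunc_self_sq_le hR0.le
        have h4 := h.integral_trunc_four_le hR0.le u
        have e : 1 - H * d / R = 99 / 100 := by rw [hR]; field_simp; norm_num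
        rw [e] at h2
        gcongr
    _ = (-(99 / 100 * t * (u ⬝ᵥ u)) + t / 16 + t ^ 2 * H * ((u ⬝ᵥ u) ^ 2 + 1 / 256)) + 1 := by
        field_simp; ring
    _ ≤ _ := Real.add_one_le_exp _

end FourthMoment

end LinReg

/-! ### From the grid to the sphere -/

namespace LinReg

variable {E : Type*} [MeasurableSpace E] {d : ℕ}

theorem log_nine_le : Real.log 9 ≤ 11 / 5 := by
  rw [Real.log_le_iff_le_exp (by norm_num)]
  have h : Real.exp (11 / 5) = Real.exp 1 ^ 2 * Real.exp (1 / 5) := by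
    rw [← Real.exp_nat_mul, ← Real.exp_add]; norm_num
  have h1 := Real.exp_one_gt_d9
  have h2 := Real.quadratic_le_exp_of_nonneg (x := 1 / 5) (by norm_num)
  have h3 : (2.718 : ℝ) ^ 2 ≤ Real.exp 1 ^ 2 := by gcongr; linarith
  rw [h]
  nlinarith [Real.exp_pos (1 / 5)]

/-- The numerical part of `le_sum_dotProduct_sq_of_grid`. -/
theorem quarter_le_of_rounding {N d H L t x X V Y : ℝ} (hd : 1 ≤ d) (hH : 1 ≤ H) (hL : 0 ≤ L)
    (ht : t = 13 / 100 / H) (hN : 80 * H * (d + 2 * L) ≤ N) (hx0 : 0 ≤ x) (hx : x ≤ 9 / 4)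
    (hg : t * (Y - X) ≤ N * (-(99 / 100 * t * x) + t / 16 + t ^ 2 * H * (x ^ 2 + 1 / 256))
      + d * x + d * Real.log 9 + L)
    (hk : t * X - (N * (99 / 100 * t - 9 / 4 * t ^ 2 * H) - d) * x ≤
      t * V - (N * (99 / 100 * t - 9 / 4 * t ^ 2 * H) - d) + t * Y) : (N + 1) / 4 ≤ V := by
  have ht0 : 0 < t := by rw [ht]; positivity
  have htH : t * H = 13 / 100 := by rw [ht]; field_simp
  have hNt : 80 * (13 / 100) * (d + 2 * L) ≤ N * t := by
    calc 80 * (13 / 100) * (d + 2 * L) = 80 * H * (d + 2 * L) * t := by rw [← htH]; ring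
      _ ≤ N * t := by gcongr
  have hN80 : (80 : ℝ) ≤ N := by nlinarith
  have e2 : t ^ 2 * H = t * (13 / 100) := by rw [← htH]; ring
  rw [show 9 / 4 * t ^ 2 * H = 9 / 4 * (t ^ 2 * H) by ring, e2] at hk
  rw [e2] at hg
  -- On $[0,9/4]$ the quadratic term is replaced by a linear one. The coefficient of $x$ in `hg`
  -- then matches the penalty in `hk`, and $x$ cancels; what remains is numerical.
  have hx2 : N * (t * x ^ 2) ≤ N * (t * (9 / 4 * x)) := by
    have : x ^ 2 ≤ 9 / 4 * x := by nlinarith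
    gcongr
  have hlog : d * Real.log 9 ≤ d * (11 / 5) := by gcongr; exact log_nine_le
  have h2 : t * 80 ≤ t * N := by gcongr
  rw [← mul_le_mul_iff_right₀ ht0]
  linarith

/-- If the exponential bounds hold at all grid points of norm at most `3/2`, then the quadratic
form is bounded below on the whole unit sphere. -/
theorem le_sum_dotProduct_sq_of_grid {N : ℕ} (hd : 0 < d) {H L t : ℝ} (hH : 1 ≤ H) (hL : 0 ≤ L)
    (hN : 80 * H * (d + 2 * L) ≤ N) (ht : t = 13 / 100 / H) (w : Fin N → Fin d → ℝ)
    (hgrid : ∀ (k : Fin d → ℤ) (θ : Fin d → ℝ), θ = (fun a => 1 / (2 * √d) * (k a : ℝ)) →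
      (∀ a, |(k a : ℝ)| ≤ 3 * d) → θ ⬝ᵥ θ ≤ 9 / 4 →
      ∑ j, t * (w j ⬝ᵥ w j / (16 * d) - (θ ⬝ᵥ w j) ^ 2) ≤
        N * (-(99 / 100 * t * (θ ⬝ᵥ θ)) + t / 16 + t ^ 2 * H * ((θ ⬝ᵥ θ) ^ 2 + 1 / 256))
          + (∑ a, (k a : ℝ) ^ 2) / 4 + d * Real.log 9 + L)
    (v : Fin d → ℝ) (hv : v ⬝ᵥ v = 1) : (N + 1) / 4 ≤ ∑ j, (v ⬝ᵥ w j) ^ 2 := by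
  have hd' : (1 : ℝ) ≤ d := by exact_mod_cast hd
  have hH0 : 0 < H := by linarith
  have ht0 : 0 < t := by rw [ht]; positivity
  have hsd : 0 < √(d : ℝ) := Real.sqrt_pos.2 (by linarith)
  have hsd2 : √(d : ℝ) ^ 2 = d := Real.sq_sqrt (by linarith)
  -- With this mesh, rounding moves a unit vector by at most $\sqrt d\,m=1/2$, so it stays in the
  -- ball of radius $3/2$, and the rounding cost $m^2/4$ is the factor $1/(16d)$ of the trace in the
  -- exponent.
  set m := 1 / (2 * √(d : ℝ)) with hm
  have hm0 : 0 < m := by positivity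
  have hm2 : m ^ 2 = 1 / (4 * d) := by rw [hm, div_pow, mul_pow, hsd2]; norm_num
  have htH : t * H = 13 / 100 := by rw [ht]; field_simp
  set α := N * (99 / 100 * t - 9 / 4 * t ^ 2 * H) - d with hα
  have hNt : 80 * (13 / 100) * (d + 2 * L) ≤ N * t := by
    calc 80 * (13 / 100) * (d + 2 * L) = 80 * H * (d + 2 * L) * t := by rw [← htH]; ring
      _ ≤ N * t := by gcongr
  have hα0 : 0 ≤ α := by
    have : 99 / 100 * t - 9 / 4 * t ^ 2 * H = t * (99 / 100 - 9 / 4 * (13 / 100)) := by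
      rw [← htH]; ring
    rw [hα, this]; nlinarith
  -- Rounding is applied to a penalized form. The penalty $\alpha\|\theta\|^2$ compensates the gain
  -- in `hgrid` that grows with $\|\theta\|^2$, so the norm of the rounded point does not matter. As
  -- $\alpha\ge0$, it only lowers the second order coefficients.
  set f : (Fin d → ℝ) → ℝ := fun θ => t * ∑ j, (θ ⬝ᵥ w j) ^ 2 - α * (θ ⬝ᵥ θ) with hf
  obtain ⟨k, hk1, hk2⟩ := exists_grid_le f (fun a => t * ∑ j, w j a ^ 2)
    (fun a => by positivity) hm0 (by
      intro θ a
      refine ⟨t * ∑ j, 2 * (θ ⬝ᵥ w j) * w j a - α * (2 * θ a), t * ∑ j, w j a ^ 2 - α,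
        by linarith, fun y => ?_⟩
      simp only [hf, add_dotProduct, dotProduct_add, single_dotProduct, dotProduct_single,
        Pi.add_apply, Pi.single_eq_same]
      have : ∑ j, (θ ⬝ᵥ w j + y * w j a) ^ 2 = ∑ j, (θ ⬝ᵥ w j) ^ 2
          + (∑ j, 2 * (θ ⬝ᵥ w j) * w j a) * y + (∑ j, w j a ^ 2) * y ^ 2 := by
        rw [Finset.sum_mul, Finset.sum_mul, ← Finset.sum_add_distrib, ← Finset.sum_add_distrib]
        exact Finset.sum_congr rfl fun j _ => by ring
      rw [this]; ring) v
  set θ : Fin d → ℝ := fun a => m * k a with hθ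
  -- the rounded point stays in the ball of radius `3/2`
  have hdiff : (θ - v) ⬝ᵥ (θ - v) ≤ 1 / 4 := by
    calc (θ - v) ⬝ᵥ (θ - v) = ∑ a, (θ a - v a) ^ 2 := by simp [dotProduct, sq]
      _ ≤ ∑ _a : Fin d, m ^ 2 := Finset.sum_le_sum fun a _ => by
          rw [← sq_abs (θ a - v a)]; gcongr; exact hk1 a
      _ = 1 / 4 := by rw [hm2]; simp; field_simp
  have hθθ : θ ⬝ᵥ θ ≤ 9 / 4 := by
    have e : θ ⬝ᵥ θ = (θ - v) ⬝ᵥ (θ - v) + 2 * (v ⬝ᵥ (θ - v)) + v ⬝ᵥ v := by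
      simp only [sub_dotProduct, dotProduct_sub, dotProduct_comm θ v]; ring
    have h1 := dotProduct_sq_le v (θ - v)
    rw [hv, one_mul] at h1
    have h2 : v ⬝ᵥ (θ - v) ≤ 1 / 2 := by nlinarith
    rw [e, hv]; linarith
  have hkb : ∀ a, |(k a : ℝ)| ≤ 3 * d := by
    intro a
    have h1 : θ a ^ 2 ≤ 9 / 4 := by
      refine le_trans ?_ hθθ
      have := Finset.single_le_sum (f := fun a => θ a * θ a) (fun b _ => mul_self_nonneg _)
        (Finset.mem_univ a)
      simpa [sq, dotProduct] using this
    have h2 : (k a : ℝ) ^ 2 ≤ 9 * d := by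
      have : θ a ^ 2 = 1 / (4 * d) * (k a : ℝ) ^ 2 := by rw [hθ, ← hm2]; ring
      rw [this, div_mul_eq_mul_div, div_le_iff₀ (by positivity)] at h1
      linarith
    refine abs_le_of_sq_le_sq (by nlinarith) (by positivity)
  have hg := hgrid k θ hθ hkb hθθ
  have hk4 : (∑ a, (k a : ℝ) ^ 2) / 4 = d * (θ ⬝ᵥ θ) := by
    have : θ ⬝ᵥ θ = 1 / (4 * d) * ∑ a, (k a : ℝ) ^ 2 := by
      rw [← hm2, Finset.mul_sum]; exact Finset.sum_congr rfl fun a _ => by rw [hθ]; ring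
    rw [this]; field_simp
  rw [hk4, ← Finset.mul_sum, Finset.sum_sub_distrib, ← Finset.sum_div] at hg
  have hq : m ^ 2 / 4 * ∑ a, t * ∑ j, w j a ^ 2 = t * ((∑ j, w j ⬝ᵥ w j) / (16 * d)) := by
    rw [← Finset.mul_sum, Finset.sum_comm, hm2]
    have : ∑ j, ∑ a, w j a ^ 2 = ∑ j, w j ⬝ᵥ w j := by simp [dotProduct, sq]
    rw [this]; field_simp; ring
  rw [hq] at hk2
  simp only [hf, hv] at hk2
  have hθ0 := dotProduct_self_nonneg θ
  exact quarter_le_of_rounding hd' hH hL ht hN hθ0 hθθ hg (by rwa [mul_one] at hk2)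

/-- **Lower tail of the empirical Gram matrix.** -/
theorem FourthMoment.measure_sum_dotProduct_sq_lt_le {P : Measure E} [IsProbabilityMeasure P]
    {w : E → Fin d → ℝ} {H : ℝ} (h : FourthMoment P w H) (hH : 1 ≤ H) (hd : 0 < d) {N : ℕ} {L : ℝ}
    (hL : 0 ≤ L) (hN : 80 * H * (d + 2 * L) ≤ N) :
    (Measure.pi fun _ : Fin N => P)
      {z | ¬ ∀ v : Fin d → ℝ, (N + 1) / 4 * (v ⬝ᵥ v) ≤ ∑ j, (v ⬝ᵥ w (z j)) ^ 2} ≤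
      ENNReal.ofReal (Real.exp (-L)) := by
  set t := 13 / 100 / H with ht
  set R := 100 * H * d with hR
  set θ : (Fin d → ℤ) → Fin d → ℝ := fun k a => 1 / (2 * √d) * (k a : ℝ) with hθ
  set κ : (Fin d → ℤ) → ℝ := fun k => -(99 / 100 * t * (θ k ⬝ᵥ θ k)) + t / 16
        + t ^ 2 * H * ((θ k ⬝ᵥ θ k) ^ 2 + 1 / 256) with hκ
  set φ : (Fin d → ℤ) → E → ℝ := fun k x =>
    Real.exp (t * (truncSq R w x ⬝ᵥ truncSq R w x / (16 * d) - (θ k ⬝ᵥ truncSq R w x) ^ 2)) with hφ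
  -- The log-moment bound $N\kappa_k$, plus minus the log-weight of the grid point $k$, plus $L$:
  -- Markov's inequality then gives `bad k` probability at most $e^{-L}$ times its weight.
  set c : (Fin d → ℤ) → ℝ := fun k => N * κ k + (∑ a, (k a : ℝ) ^ 2) / 4 + d * Real.log 9 + L with hc
  set π := Measure.pi fun _ : Fin N => P
  set s := Fintype.piFinset fun _ : Fin d => Finset.Icc (-((3 * d : ℕ) : ℤ)) ((3 * d : ℕ) : ℤ)
  set bad : (Fin d → ℤ) → Set (Fin N → E) := fun k => {z | Real.exp (c k) ≤ ∏ j, φ k (z j)}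
  have hH0 : 0 < H := by linarith
  have ht0 : 0 < t := by positivity
  have hR0 : 0 ≤ R := by positivity
  have hsub : {z : Fin N → E | ¬ ∀ v : Fin d → ℝ, (N + 1) / 4 * (v ⬝ᵥ v) ≤
      ∑ j, (v ⬝ᵥ w (z j)) ^ 2} ⊆ ⋃ k ∈ s, bad k := by
    intro z hz
    by_contra hcon
    refine hz ?_
    simp only [Set.mem_iUnion, not_exists] at hcon
    have hunit := le_sum_dotProduct_sq_of_grid hd hH hL hN ht (fun j => truncSq R w (z j)) (by
      rintro k _ rfl hk _
      have hks : k ∈ s := by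
        rw [Fintype.mem_piFinset]
        intro a
        rw [Finset.mem_Icc, ← abs_le]
        have := hk a
        exact_mod_cast this
      have h1 := hcon k hks
      simp only [bad, Set.mem_ofPred_eq, not_le, hφ, ← Real.exp_sum, Real.exp_lt_exp] at h1
      exact h1.le)
    intro v
    -- Both sides are homogeneous of degree 2 in `v`, which reduces the claim to unit vectors;
    -- undoing the truncation only increases the right side.
    rcases (dotProduct_self_nonneg v).eq_or_lt with h0 | h0
    · rw [← h0, mul_zero]; positivity
    set r := √(v ⬝ᵥ v)
    have hr : r ^ 2 = v ⬝ᵥ v := Real.sq_sqrt h0.le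
    have hr0 : 0 < r := Real.sqrt_pos.2 h0
    have h1 := hunit (r⁻¹ • v) (by
      simp only [smul_dotProduct, dotProduct_smul, smul_eq_mul]; rw [← hr]; field_simp)
    simp only [smul_dotProduct, smul_eq_mul, mul_pow, ← Finset.mul_sum] at h1
    have h2 : ∑ j, (v ⬝ᵥ truncSq R w (z j)) ^ 2 ≤ ∑ j, (v ⬝ᵥ w (z j)) ^ 2 :=
      Finset.sum_le_sum fun j _ => dotProduct_truncSq_sq_le R w v (z j)
    rw [inv_pow, inv_mul_eq_div, le_div_iff₀ (by positivity), hr] at h1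
    exact h1.trans h2
  have hφm : ∀ k, Measurable (φ k) := fun k => by
    have := measurable_truncSq R h.measurable
    fun_prop
  have hφi : ∀ k, Integrable (φ k) P := fun k => by
    refine integrable_of_bounded (hφm k) (B := Real.exp (t * (R / (16 * d)))) fun x => ?_
    rw [abs_of_pos (Real.exp_pos _)]
    refine Real.exp_le_exp.2 (mul_le_mul_of_nonneg_left ?_ ht0.le)
    have h1 : truncSq R w x ⬝ᵥ truncSq R w x / (16 * d) ≤ R / (16 * d) := by
      gcongr; exact truncSq_dotProduct_self_le hR0 w x
    linarith [sq_nonneg (θ k ⬝ᵥ truncSq R w x)]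
  have hbad : ∀ k, π.real (bad k) ≤
      Real.exp (-L) * (9 ^ d)⁻¹ * Real.exp (-((∑ a, (k a : ℝ) ^ 2) / 4)) := by
    intro k
    have h1 := mul_meas_ge_le_integral_of_nonneg (μ := π) (f := fun z => ∏ j, φ k (z j))
      (ae_of_all _ fun z => Finset.prod_nonneg fun j _ => (Real.exp_pos _).le)
      (Integrable.fintype_prod fun _ => hφi k) (Real.exp (c k))
    rw [integral_fintype_prod_eq_pow, Fintype.card_fin] at h1
    have h2 : (∫ x, φ k x ∂P) ^ N ≤ Real.exp (N * κ k) := by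
      rw [Real.exp_nat_mul]
      exact pow_le_pow_left₀ (integral_nonneg fun _ => (Real.exp_pos _).le)
        (h.integral_exp_trunc_le hH hd (θ k) ht hR) N
    have h3 : π.real (bad k) ≤ Real.exp (N * κ k) / Real.exp (c k) := by
      rw [le_div_iff₀ (Real.exp_pos _), mul_comm]; exact h1.trans h2
    refine h3.trans_eq ?_
    have h9 : ((9 : ℝ) ^ d)⁻¹ = Real.exp (-(d * Real.log 9)) := by
      rw [Real.exp_neg, Real.exp_nat_mul, Real.exp_log (by norm_num)]
    rw [← Real.exp_sub, h9, ← Real.exp_add, ← Real.exp_add]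
    congr 1
    simp only [hc]; ring
  have hfin : π.real (⋃ k ∈ s, bad k) ≤ Real.exp (-L) := by
    calc π.real (⋃ k ∈ s, bad k) ≤ ∑ k ∈ s, π.real (bad k) := measureReal_biUnion_finset_le s bad
      _ ≤ ∑ k ∈ s, Real.exp (-L) * (9 ^ d)⁻¹ * Real.exp (-((∑ a, (k a : ℝ) ^ 2) / 4)) :=
          Finset.sum_le_sum fun k _ => hbad k
      _ ≤ Real.exp (-L) * (9 ^ d)⁻¹ * 9 ^ d := by
          rw [← Finset.mul_sum]
          gcongr
          exact sum_exp_neg_dotProduct_le d (3 * d)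
      _ = Real.exp (-L) := by field_simp
  refine (measure_mono hsub).trans ?_
  rw [ENNReal.le_ofReal_iff_toReal_le (measure_ne_top _ _) (Real.exp_pos _).le]
  exact hfin

end LinReg

namespace LinReg

/-! ### Moments of truncated sums -/

theorem add_rpow_le_two_rpow_mul {x y p : ℝ} (hx : 0 ≤ x) (hy : 0 ≤ y) (hp : 0 ≤ p) :
    (x + y) ^ p ≤ 2 ^ p * (x ^ p + y ^ p) := by
  wlog h : x ≤ y generalizing x y
  · rw [add_comm x, add_comm (x ^ p)]; exact this hy hx (le_of_not_ge h)
  calc (x + y) ^ p ≤ (2 * y) ^ p := by gcongr; linarith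
    _ = 2 ^ p * y ^ p := Real.mul_rpow (by norm_num) hy
    _ ≤ _ := by
      have : 0 ≤ x ^ p := by positivity
      gcongr; linarith

/-- Truncation of a vector at norm `M`. -/
noncomputable def truncNorm {F : Type*} [NormedAddCommGroup F] (M : ℝ) (z : F) : F :=
  if ‖z‖ ≤ M then z else 0

section truncNorm

variable {F : Type*} [NormedAddCommGroup F]

theorem truncNorm_of_le {M : ℝ} {z : F} (h : ‖z‖ ≤ M) : truncNorm M z = z := if_pos h

theorem norm_truncNorm_le {M : ℝ} (hM : 0 ≤ M) (z : F) : ‖truncNorm M z‖ ≤ M := by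
  unfold truncNorm; split_ifs with h
  · exact h
  · simpa using hM

theorem norm_truncNorm_le_self (M : ℝ) (z : F) : ‖truncNorm M z‖ ≤ ‖z‖ := by
  unfold truncNorm; split_ifs with h <;> simp

theorem measurable_truncNorm [MeasurableSpace F] [BorelSpace F] (M : ℝ) :
    Measurable (truncNorm M : F → F) :=
  Measurable.ite (measurableSet_le measurable_norm measurable_const) measurable_id measurable_const

theorem norm_sub_truncNorm_le {M s : ℝ} (hM : 0 < M) (hs : 1 ≤ s) (z : F) :
    ‖z - truncNorm M z‖ ≤ M ^ (1 - s) * ‖z‖ ^ s := by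
  unfold truncNorm; split_ifs with h
  · simp; positivity
  · push Not at h
    have hz : 0 < ‖z‖ := hM.trans h
    rw [sub_zero]
    calc ‖z‖ = ‖z‖ ^ (1 - s) * ‖z‖ ^ s := by rw [← Real.rpow_add hz]; simp
      _ ≤ _ := by
        gcongr ?_ * _
        exact Real.rpow_le_rpow_of_nonpos hM h.le (by linarith)

theorem norm_truncNorm_rpow_le {M s p : ℝ} (hM : 0 < M) (hs : 0 < s) (hsp : s ≤ p) (z : F) :
    ‖truncNorm M z‖ ^ p ≤ M ^ (p - s) * ‖z‖ ^ s := by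
  unfold truncNorm; split_ifs with h
  · rcases (norm_nonneg z).eq_or_lt with h0 | hz
    · rw [← h0, Real.zero_rpow (by linarith), Real.zero_rpow (by linarith), mul_zero]
    calc ‖z‖ ^ p = ‖z‖ ^ (p - s) * ‖z‖ ^ s := by rw [← Real.rpow_add hz]; simp
      _ ≤ _ := by gcongr
  · rw [norm_zero, Real.zero_rpow (by linarith)]; positivity

end truncNorm

set_option maxHeartbeats 1000000 in
/-- Moments of order `p` of a sum of truncated centered vectors with finite moments of order
`s ≤ p`. -/
theorem exists_integral_truncNorm_sum_le {p : ℝ} (hp : 4 ≤ p) : ∃ C : ℝ, 1 ≤ C ∧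
    ∀ {F : Type*} [NormedAddCommGroup F] [InnerProductSpace ℝ F] [CompleteSpace F]
      [MeasurableSpace F] [BorelSpace F] [SecondCountableTopology F] {E : Type*} [MeasurableSpace E]
      (P : Measure E) [IsProbabilityMeasure P] (Z : E → F) (_ : Measurable Z) (s A : ℝ) (_ : 2 ≤ s)
      (_ : s ≤ p) (_ : 0 < A) (_ : Integrable (fun x => ‖Z x‖ ^ s) P)
      (_ : ∫ x, ‖Z x‖ ^ s ∂P ≤ A ^ s) (_ : ∫ x, Z x ∂P = 0) (n ℓ : ℝ) (_ : 1 ≤ n) (_ : n ≤ ℓ)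
      (N : ℕ) (_ : (N : ℝ) ≤ n),
      ∫ z, ‖∑ j, truncNorm (A * ℓ ^ (1 / s)) (Z (z j))‖ ^ p ∂(Measure.pi fun _ : Fin N => P) ≤
        (C * (A * (n ^ (1 / 2 : ℝ) + (n / ℓ) ^ (1 / p) * ℓ ^ (1 / s)))) ^ p := by
  obtain ⟨C₀, hC₀, hros⟩ := exists_integral_norm_sum_rpow_le hp
  have hp0 : 0 < p := by linarith
  have h2p : (1 : ℝ) ≤ 2 ^ p := Real.one_le_rpow (by norm_num) hp0.le
  -- The two summands dominate the constants of the $p$-th moment and of the variance of the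
  -- recentered truncated vector.
  set c := C₀ * (2 * 2 ^ p) + 6 * C₀ with hc
  have hc1 : 1 ≤ c := by nlinarith
  refine ⟨4 * c, by linarith, ?_⟩
  intro F _ _ _ _ _ _ E _ P _ Z hZ s A hs hsp hA hi hmom hmean n ℓ hn hnℓ N hN
  have hℓ : 1 ≤ ℓ := hn.trans hnℓ
  have hℓ0 : 0 < ℓ := by linarith
  have hs0 : 0 < s := by linarith
  have hℓs : 0 < ℓ ^ (1 / s) := Real.rpow_pos_of_pos hℓ0 _
  set M := A * ℓ ^ (1 / s) with hM
  have hM0 : 0 < M := by positivity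
  have hMpow : ∀ a : ℝ, M ^ a = A ^ a * ℓ ^ (a / s) := fun a => by
    rw [hM, Real.mul_rpow hA.le hℓs.le, ← Real.rpow_mul hℓ0.le]; congr 2; ring
  set Z' : E → F := fun x => truncNorm M (Z x) with hZ'
  have hZ'm : Measurable Z' := (measurable_truncNorm M).comp hZ
  have hZ'b : ∀ x, ‖Z' x‖ ≤ M := fun x => norm_truncNorm_le hM0.le _
  have hZ'i : Integrable Z' P :=
    Integrable.of_bound hZ'm.aestronglyMeasurable M (ae_of_all _ hZ'b)
  have hZi : Integrable Z P := by
    refine ((integrable_const (1 : ℝ)).add hi).mono' hZ.aestronglyMeasurable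
      (ae_of_all _ fun x => ?_)
    have := rpow_le_rpow_mul_rpow_add_rpow (norm_nonneg (Z x)) one_pos zero_le_one
      (by linarith : 1 ≤ s)
    simp only [Real.one_rpow, Real.rpow_one, one_mul] at this
    simp only [Pi.add_apply]; linarith
  set a := ∫ x, Z' x ∂P with ha
  -- Truncation creates a bias. Since `Z` is centered, it is minus the mean of the discarded tail,
  -- hence at most $M^{1-s}A^s=A\,\ell^{1/s-1}$.
  have hna : ‖a‖ ≤ A * (ℓ ^ (1 / s) / ℓ) := by
    have h1 : a = -∫ x, (Z x - Z' x) ∂P := by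
      rw [integral_sub hZi hZ'i, hmean, zero_sub, neg_neg]
    rw [h1, norm_neg]
    calc _ ≤ ∫ x, ‖Z x - Z' x‖ ∂P := norm_integral_le_integral_norm _
      _ ≤ ∫ x, M ^ (1 - s) * ‖Z x‖ ^ s ∂P :=
          integral_mono (hZi.sub hZ'i).norm (hi.const_mul _)
            fun x => norm_sub_truncNorm_le hM0 (by linarith) _
      _ ≤ M ^ (1 - s) * A ^ s := by rw [integral_const_mul]; gcongr
      _ = A * (ℓ ^ (1 / s) / ℓ) := by
          rw [hMpow, show (1 - s) / s = 1 / s - 1 by field_simp, Real.rpow_sub_one hℓ0.ne']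
          rw [mul_right_comm, ← Real.rpow_add hA]; simp
  have hℓle : ℓ ^ (1 / s) ≤ ℓ := by
    calc ℓ ^ (1 / s) ≤ ℓ ^ (1 : ℝ) :=
          Real.rpow_le_rpow_of_exponent_le hℓ (by rw [div_le_one hs0]; linarith)
      _ = ℓ := Real.rpow_one ℓ
  have hnaA : ‖a‖ ≤ A := by
    refine hna.trans ?_
    have : ℓ ^ (1 / s) / ℓ ≤ 1 := by rwa [div_le_one hℓ0]
    nlinarith
  have hZ'2 : ∫ x, ‖Z' x‖ ^ 2 ∂P ≤ 2 * A ^ 2 := by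
    calc _ ≤ ∫ x, (A ^ (2 - s) * ‖Z x‖ ^ s + A ^ 2) ∂P := by
          refine integral_mono_of_nonneg (ae_of_all _ fun _ => by positivity)
            ((hi.const_mul _).add (integrable_const _)) (ae_of_all _ fun x => ?_)
          have := rpow_le_rpow_mul_rpow_add_rpow (norm_nonneg (Z x)) hA zero_le_two hs
          simp only [Real.rpow_two] at this
          refine le_trans ?_ this
          dsimp only
          gcongr; exact norm_truncNorm_le_self _ _
      _ = A ^ (2 - s) * ∫ x, ‖Z x‖ ^ s ∂P + A ^ 2 := by
          rw [integral_add (hi.const_mul _) (integrable_const _), integral_const_mul]; simp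
      _ ≤ A ^ (2 - s) * A ^ s + A ^ 2 := by gcongr
      _ = 2 * A ^ 2 := by rw [← Real.rpow_add hA]; simp; ring
  have hZ'p : ∫ x, ‖Z' x‖ ^ p ∂P ≤ A ^ p * (ℓ ^ (p / s) / ℓ) := by
    calc _ ≤ ∫ x, M ^ (p - s) * ‖Z x‖ ^ s ∂P :=
          integral_mono_of_nonneg (ae_of_all _ fun _ => by positivity) (hi.const_mul _)
            (ae_of_all _ fun x => norm_truncNorm_rpow_le hM0 hs0 hsp _)
      _ ≤ M ^ (p - s) * A ^ s := by rw [integral_const_mul]; gcongr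
      _ = _ := by
          rw [hMpow, show (p - s) / s = p / s - 1 by field_simp, Real.rpow_sub_one hℓ0.ne']
          rw [mul_right_comm, ← Real.rpow_add hA]; simp
  have hap : ‖a‖ ^ p ≤ A ^ p * (ℓ ^ (p / s) / ℓ) := by
    calc ‖a‖ ^ p ≤ (A * (ℓ ^ (1 / s) / ℓ)) ^ p := by gcongr
      _ = A ^ p * (ℓ ^ (p / s) / ℓ ^ p) := by
          rw [Real.mul_rpow hA.le (by positivity), Real.div_rpow hℓs.le hℓ0.le,
            ← Real.rpow_mul hℓ0.le]
          congr 3; ring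
      _ ≤ _ := by
          gcongr
          calc ℓ = ℓ ^ (1 : ℝ) := (Real.rpow_one ℓ).symm
            _ ≤ ℓ ^ p := Real.rpow_le_rpow_of_exponent_le hℓ (by linarith)
  set g : E → F := fun x => Z' x - a with hg
  have hgm : Measurable g := hZ'm.sub_const a
  have hgb : ∀ x, ‖g x‖ ≤ M + A := fun x => (norm_sub_le _ _).trans (add_le_add (hZ'b x) hnaA)
  have hgmean : ∀ u, ∫ x, inner ℝ u (g x) ∂P = 0 := by
    intro u
    rw [integral_inner (by exact hZ'i.sub (integrable_const a)),
      integral_sub hZ'i (integrable_const a)]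
    simp [ha]
  have i2 : Integrable (fun x => ‖Z' x‖ ^ 2) P :=
    integrable_of_bounded (by fun_prop) (B := M ^ 2) fun x => by
      rw [abs_of_nonneg (by positivity)]; gcongr; exact hZ'b x
  have ip : Integrable (fun x => ‖Z' x‖ ^ p) P :=
    integrable_of_bounded (by fun_prop) (B := M ^ p) fun x => by
      rw [abs_of_nonneg (by positivity)]; gcongr; exact hZ'b x
  have hg2 : ∫ x, ‖g x‖ ^ 2 ∂P ≤ 6 * A ^ 2 := by
    calc _ ≤ ∫ x, (2 * ‖Z' x‖ ^ 2 + 2 * A ^ 2) ∂P := by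
          refine integral_mono_of_nonneg (ae_of_all _ fun _ => by positivity)
            ((i2.const_mul _).add (integrable_const _)) (ae_of_all _ fun x => ?_)
          have h1 : ‖g x‖ ≤ ‖Z' x‖ + A := (norm_sub_le _ _).trans (by gcongr)
          have h2 : ‖g x‖ ^ 2 ≤ (‖Z' x‖ + A) ^ 2 := by gcongr
          dsimp only
          nlinarith [sq_nonneg (‖Z' x‖ - A)]
      _ = 2 * ∫ x, ‖Z' x‖ ^ 2 ∂P + 2 * A ^ 2 := by
          rw [integral_add (i2.const_mul _) (integrable_const _), integral_const_mul]; simp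
      _ ≤ _ := by linarith
  have hgp : ∫ x, ‖g x‖ ^ p ∂P ≤ 2 * 2 ^ p * (A ^ p * (ℓ ^ (p / s) / ℓ)) := by
    calc _ ≤ ∫ x, 2 ^ p * (‖Z' x‖ ^ p + ‖a‖ ^ p) ∂P := by
          refine integral_mono_of_nonneg (ae_of_all _ fun _ => by positivity)
            ((ip.add (integrable_const _)).const_mul _) (ae_of_all _ fun x => ?_)
          refine le_trans ?_ (add_rpow_le_two_rpow_mul (norm_nonneg _) (norm_nonneg _) hp0.le)
          dsimp only
          gcongr; exact norm_sub_le _ _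
      _ = 2 ^ p * ((∫ x, ‖Z' x‖ ^ p ∂P) + ‖a‖ ^ p) := by
          rw [integral_const_mul, integral_add ip (integrable_const _)]; simp
      _ ≤ 2 ^ p * (A ^ p * (ℓ ^ (p / s) / ℓ) + A ^ p * (ℓ ^ (p / s) / ℓ)) := by gcongr
      _ = _ := by ring
  -- The first summand is the scale set by the variance, the second is the $p$-th root of
  -- $n\,\ell^{p/s}/\ell$, the scale set by the truncated $p$-th moments.
  set κ := n ^ (1 / 2 : ℝ) + (n / ℓ) ^ (1 / p) * ℓ ^ (1 / s) with hκ
  have hn0 : 0 < n := by linarith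
  have hr1 : 0 < n ^ (1 / 2 : ℝ) := by positivity
  have hr2 : 0 < (n / ℓ) ^ (1 / p) * ℓ ^ (1 / s) := by positivity
  have hκ0 : 0 < κ := by positivity
  set D := c * (A * κ) with hD
  have hD0 : 0 < D := by positivity
  have hDvar : C₀ * n * ∫ x, ‖g x‖ ^ 2 ∂P ≤ D ^ 2 := by
    have h1 : n ≤ κ ^ 2 := by
      have : n = (n ^ (1 / 2 : ℝ)) ^ 2 := by
        rw [← Real.rpow_natCast, ← Real.rpow_mul hn0.le]; norm_num
      rw [this]; gcongr; rw [hκ]; linarith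
    have h2 : C₀ * 6 ≤ c ^ 2 := by nlinarith
    calc C₀ * n * ∫ x, ‖g x‖ ^ 2 ∂P ≤ C₀ * κ ^ 2 * (6 * A ^ 2) := by gcongr
      _ = C₀ * 6 * (A * κ) ^ 2 := by ring
      _ ≤ c ^ 2 * (A * κ) ^ 2 := by gcongr
      _ = D ^ 2 := by rw [hD]; ring
  have hDmom : C₀ * n * ∫ x, ‖g x‖ ^ p ∂P ≤ D ^ p := by
    have h1 : n / ℓ * ℓ ^ (p / s) ≤ κ ^ p := by
      have : n / ℓ * ℓ ^ (p / s) = ((n / ℓ) ^ (1 / p) * ℓ ^ (1 / s)) ^ p := by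
        rw [Real.mul_rpow (by positivity) hℓs.le, ← Real.rpow_mul (by positivity),
          ← Real.rpow_mul hℓ0.le, one_div_mul_cancel hp0.ne', Real.rpow_one]
        congr 2; ring
      rw [this]; gcongr; rw [hκ]; linarith
    have h2 : C₀ * (2 * 2 ^ p) ≤ c ^ p := by
      calc C₀ * (2 * 2 ^ p) ≤ c := by linarith
        _ = c ^ (1 : ℝ) := (Real.rpow_one c).symm
        _ ≤ c ^ p := Real.rpow_le_rpow_of_exponent_le hc1 (by linarith)
    calc C₀ * n * ∫ x, ‖g x‖ ^ p ∂P ≤ C₀ * n * (2 * 2 ^ p * (A ^ p * (ℓ ^ (p / s) / ℓ))) := by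
          gcongr
      _ = C₀ * (2 * 2 ^ p) * (A ^ p * (n / ℓ * ℓ ^ (p / s))) := by ring
      _ ≤ c ^ p * (A ^ p * κ ^ p) := by gcongr
      _ = D ^ p := by
          rw [hD, Real.mul_rpow (by linarith) (by positivity), Real.mul_rpow hA.le hκ0.le]
  have hmain := hros P g hgm (M + A) hgb hgmean n D hn0 hD0 hDvar hDmom N hN
  -- The accumulated bias is of the heavy-tail scale, because $n/\ell\le(n/\ell)^{1/p}$. The factor
  -- 4 in the final constant covers adding it back.
  have hbias : N * ‖a‖ ≤ D := by
    have h1 : n / ℓ ≤ (n / ℓ) ^ (1 / p) := by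
      have h01 : n / ℓ ≤ 1 := by rwa [div_le_one hℓ0]
      calc n / ℓ = (n / ℓ) ^ (1 : ℝ) := (Real.rpow_one _).symm
        _ ≤ _ := Real.rpow_le_rpow_of_exponent_ge (by positivity) h01
          (by rw [div_le_one hp0]; linarith)
    calc N * ‖a‖ ≤ n * (A * (ℓ ^ (1 / s) / ℓ)) := by gcongr
      _ = A * (n / ℓ * ℓ ^ (1 / s)) := by ring
      _ ≤ A * κ := by
          gcongr
          rw [hκ]
          have : n / ℓ * ℓ ^ (1 / s) ≤ (n / ℓ) ^ (1 / p) * ℓ ^ (1 / s) := by gcongr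
          linarith
      _ ≤ D := by
          have : 0 ≤ A * κ := by positivity
          rw [hD]; nlinarith
  have hND : (N : ℝ) / n * D ^ p ≤ D ^ p := by
    have : (N : ℝ) / n ≤ 1 := by rwa [div_le_one hn0]
    have h0 : 0 ≤ D ^ p := by positivity
    nlinarith
  have hsumi : Integrable (fun z : Fin N → E => ‖∑ j, g (z j)‖ ^ p)
      (Measure.pi fun _ : Fin N => P) := by
    have hm : Measurable fun z : Fin N → E => ∑ j, g (z j) :=
      Finset.measurable_sum _ fun j _ => hgm.comp (measurable_pi_apply j)
    refine integrable_of_bounded (by fun_prop) (B := (N * (M + A)) ^ p) fun z => ?_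
    rw [abs_of_nonneg (by positivity)]
    gcongr
    refine (norm_sum_le _ _).trans ?_
    simpa [mul_add] using Finset.sum_le_sum fun j (_ : j ∈ Finset.univ) => hgb (z j)
  calc _ ≤ ∫ z : Fin N → E, 2 ^ p * (‖∑ j, g (z j)‖ ^ p + D ^ p)
            ∂(Measure.pi fun _ : Fin N => P) := by
        refine integral_mono_of_nonneg (ae_of_all _ fun _ => by positivity)
          ((hsumi.add (integrable_const _)).const_mul _) (ae_of_all _ fun z => ?_)
        refine le_trans ?_ (add_rpow_le_two_rpow_mul (norm_nonneg _) hD0.le hp0.le)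
        dsimp only
        gcongr
        have e : ∑ j, truncNorm M (Z (z j)) = ∑ j, g (z j) + (N : ℝ) • a := by
          simp [hg, hZ', Finset.sum_sub_distrib, Nat.cast_smul_eq_nsmul]
        rw [e]
        refine (norm_add_le _ _).trans ?_
        gcongr
        rwa [norm_smul, Real.norm_of_nonneg (Nat.cast_nonneg N)]
    _ = 2 ^ p * ((∫ z : Fin N → E, ‖∑ j, g (z j)‖ ^ p ∂(Measure.pi fun _ : Fin N => P)) + D ^ p) := by
        rw [integral_const_mul, integral_add hsumi (integrable_const _)]; simp
    _ ≤ 2 ^ p * (2 * D ^ p) := by gcongr; linarith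
    _ ≤ 2 ^ p * (2 ^ p * D ^ p) := by
        gcongr
        calc (2 : ℝ) = 2 ^ (1 : ℝ) := (Real.rpow_one 2).symm
          _ ≤ 2 ^ p := Real.rpow_le_rpow_of_exponent_le (by norm_num) (by linarith)
    _ = (4 * D) ^ p := by
        rw [← mul_assoc, ← Real.mul_rpow (by norm_num) (by norm_num),
          ← Real.mul_rpow (by norm_num) hD0.le]; norm_num
    _ = _ := by rw [hD]; congr 1; ring

end LinReg

namespace LinReg

/-! ### Leave-one-out solutions of the normal equations -/

variable {d N : ℕ}

/-- The unnormalized empirical Gram matrix. -/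
def normalMatrix (w : Fin N → Fin d → ℝ) : Matrix (Fin d) (Fin d) ℝ :=
  ∑ j, Matrix.vecMulVec (w j) (w j)

theorem normalMatrix_mulVec (w : Fin N → Fin d → ℝ) (v : Fin d → ℝ) :
    normalMatrix w *ᵥ v = ∑ j, (w j ⬝ᵥ v) • w j := by
  simp only [normalMatrix, Matrix.sum_mulVec, Matrix.vecMulVec_mulVec]
  simp

theorem normalMatrix_mulVec_dotProduct (w : Fin N → Fin d → ℝ) (v : Fin d → ℝ) :
    v ⬝ᵥ (normalMatrix w *ᵥ v) = ∑ j, (v ⬝ᵥ w j) ^ 2 := by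
  rw [normalMatrix_mulVec, dotProduct_sum]
  refine Finset.sum_congr rfl fun j _ => ?_
  rw [dotProduct_smul, smul_eq_mul, dotProduct_comm (w j) v, sq]

theorem isUnit_normalMatrix {w : Fin N → Fin d → ℝ} {c : ℝ} (hc : 0 < c)
    (hw : ∀ v : Fin d → ℝ, c * (v ⬝ᵥ v) ≤ ∑ j, (v ⬝ᵥ w j) ^ 2) : IsUnit (normalMatrix w) := by
  rw [← Matrix.mulVec_injective_iff_isUnit, ← Matrix.coe_mulVecLin, injective_iff_map_eq_zero]
  intro v hv
  rw [Matrix.mulVecLin_apply] at hv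
  have h1 := hw v
  rw [← normalMatrix_mulVec_dotProduct, hv, dotProduct_zero] at h1
  have h2 := dotProduct_self_nonneg v
  exact dotProduct_self_eq_zero.1 (by nlinarith)

/-- The solution of the normal equations with right-hand side `S`, replaced by `0` when it is
longer than `c⁻¹` times `S`. -/
noncomputable def normalSolution (c : ℝ) (w : Fin N → Fin d → ℝ) (S : Fin d → ℝ) : Fin d → ℝ :=
  if c ^ 2 * (((normalMatrix w)⁻¹ *ᵥ S) ⬝ᵥ ((normalMatrix w)⁻¹ *ᵥ S)) ≤ S ⬝ᵥ S then
    (normalMatrix w)⁻¹ *ᵥ S else 0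

/-- The cutoff makes this hold for all data. Moments of `S` thus pass to the solution without
conditioning on a well-behaved Gram matrix, which would complicate the independence argument. -/
theorem normalSolution_le (c : ℝ) (w : Fin N → Fin d → ℝ) (S : Fin d → ℝ) :
    c ^ 2 * (normalSolution c w S ⬝ᵥ normalSolution c w S) ≤ S ⬝ᵥ S := by
  unfold normalSolution; split_ifs with h
  · exact h
  · simpa using dotProduct_self_nonneg S

/-- For a well-conditioned Gram matrix $A$ the cutoff is inactive: with $Ag=S$, $c\|g\|^2\le g\cdot
Ag=g\cdot S\le\|g\|\|S\|$. -/
theorem normalSolution_eq {w : Fin N → Fin d → ℝ} {c : ℝ} (hc : 0 < c)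
    (hw : ∀ v : Fin d → ℝ, c * (v ⬝ᵥ v) ≤ ∑ j, (v ⬝ᵥ w j) ^ 2) (S : Fin d → ℝ) :
    normalSolution c w S = (normalMatrix w)⁻¹ *ᵥ S := by
  refine if_pos ?_
  have hu := isUnit_normalMatrix hc hw
  set g := (normalMatrix w)⁻¹ *ᵥ S with hg
  have hAg : normalMatrix w *ᵥ g = S := by
    rw [hg, Matrix.mulVec_mulVec, Matrix.mul_nonsing_inv _ ((Matrix.isUnit_iff_isUnit_det _).1 hu),
      Matrix.one_mulVec]
  have h1 := hw g
  rw [← normalMatrix_mulVec_dotProduct, hAg] at h1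
  have h2 := dotProduct_sq_le g S
  have h3 := dotProduct_self_nonneg g
  rcases h3.eq_or_lt with h0 | h0
  · rw [← h0, mul_zero]; exact dotProduct_self_nonneg S
  have h4 : (c * (g ⬝ᵥ g)) ^ 2 ≤ (g ⬝ᵥ g) * (S ⬝ᵥ S) := by
    refine le_trans ?_ h2
    gcongr
  have h5 : (g ⬝ᵥ g) * (c ^ 2 * (g ⬝ᵥ g)) ≤ (g ⬝ᵥ g) * (S ⬝ᵥ S) := by nlinarith
  exact le_of_mul_le_mul_left h5 h0

theorem continuous_normalMatrix :
    Continuous (normalMatrix : (Fin N → Fin d → ℝ) → Matrix (Fin d) (Fin d) ℝ) := by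
  unfold normalMatrix
  refine continuous_finsetSum _ fun j _ => ?_
  exact Continuous.matrix_vecMulVec (continuous_apply j) (continuous_apply j)

/-- The inverse is discontinuous at singular matrices, but it is the inverted determinant times the
adjugate, and this product is measurable everywhere. -/
theorem measurable_normalSolution (c : ℝ) :
    Measurable fun y : (Fin N → Fin d → ℝ) × (Fin d → ℝ) => normalSolution c y.1 y.2 := by
  have h1 : Measurable fun y : (Fin N → Fin d → ℝ) × (Fin d → ℝ) =>
      (normalMatrix y.1)⁻¹ *ᵥ y.2 := by
    have hc := (continuous_normalMatrix (d := d) (N := N)).comp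
      (continuous_fst : Continuous fun y : (Fin N → Fin d → ℝ) × (Fin d → ℝ) => y.1)
    have hdet : Measurable fun y : (Fin N → Fin d → ℝ) × (Fin d → ℝ) =>
      (normalMatrix y.1).det := hc.matrix_det.measurable
    have hadj : Measurable fun y : (Fin N → Fin d → ℝ) × (Fin d → ℝ) =>
      (normalMatrix y.1).adjugate *ᵥ y.2 :=
      (Continuous.matrix_mulVec hc.matrix_adjugate continuous_snd).measurable
    have e : (fun y : (Fin N → Fin d → ℝ) × (Fin d → ℝ) => (normalMatrix y.1)⁻¹ *ᵥ y.2) =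
        fun y => ((normalMatrix y.1).det)⁻¹ • ((normalMatrix y.1).adjugate *ᵥ y.2) := by
      ext1 y
      rw [Matrix.inv_def, Matrix.smul_mulVec, Ring.inverse_eq_inv']
    rw [e]
    exact hdet.inv.smul hadj
  unfold normalSolution
  refine Measurable.ite (measurableSet_le ?_ ?_) h1 measurable_const
  · exact (measurable_dotProduct h1 h1).const_mul _
  · exact measurable_dotProduct measurable_snd measurable_snd

/-- A leave-one-out bound for fitted values: removing the observation `i` changes the fit at `i` by
at most its leverage times its error. -/
theorem abs_fitted_le {w : Fin (N + 1) → Fin d → ℝ} {e : Fin (N + 1) → ℝ} {θ : Fin d → ℝ}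
    (hnormal : ∑ j, (e j - w j ⬝ᵥ θ) • w j = 0) (i : Fin (N + 1)) {c : ℝ} (hc : 0 < c)
    (hw : ∀ v : Fin d → ℝ, c * (v ⬝ᵥ v) ≤ ∑ j, (v ⬝ᵥ w (i.succAbove j)) ^ 2) :
    |w i ⬝ᵥ θ| ≤ |normalSolution c (fun j => w (i.succAbove j))
        (∑ j, e (i.succAbove j) • w (i.succAbove j)) ⬝ᵥ w i| + c⁻¹ * ((w i ⬝ᵥ w i) * |e i|) := by
  set A := normalMatrix fun j => w (i.succAbove j) with hA
  set S := ∑ j, e (i.succAbove j) • w (i.succAbove j) with hS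
  rw [normalSolution_eq hc hw]
  have hu : IsUnit A.det := (Matrix.isUnit_iff_isUnit_det _).1 (isUnit_normalMatrix hc hw)
  have hAθ : A *ᵥ θ = S + (e i - w i ⬝ᵥ θ) • w i := by
    rw [Fin.sum_univ_succAbove _ i] at hnormal
    simp only [sub_smul, Finset.sum_sub_distrib] at hnormal
    rw [hA, normalMatrix_mulVec, sub_smul]
    have := sub_eq_zero.1 (show ∑ j, (w (i.succAbove j) ⬝ᵥ θ) • w (i.succAbove j) -
      (S + (e i • w i - (w i ⬝ᵥ θ) • w i)) = 0 by
        rw [← neg_eq_zero, ← hnormal, hS]; abel)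
    exact this
  set u := A⁻¹ *ᵥ w i with hu'
  have hAu : A *ᵥ u = w i := by
    rw [hu', Matrix.mulVec_mulVec, Matrix.mul_nonsing_inv _ hu, Matrix.one_mulVec]
  have hθ : θ = A⁻¹ *ᵥ S + (e i - w i ⬝ᵥ θ) • u := by
    have := congrArg (A⁻¹ *ᵥ ·) hAθ
    simpa [Matrix.mulVec_mulVec, Matrix.nonsing_inv_mul _ hu, Matrix.mulVec_add,
      Matrix.mulVec_smul] using this
  have hℓ := hw u
  rw [← normalMatrix_mulVec_dotProduct, ← hA, hAu] at hℓ
  have huu := dotProduct_self_nonneg u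
  have hℓ0 : 0 ≤ u ⬝ᵥ w i := le_trans (by positivity) hℓ
  have hww := dotProduct_self_nonneg (w i)
  -- The leverage: $(u\cdot w_i)^2\le\|u\|^2\|w_i\|^2$ and $c\|u\|^2\le u\cdot w_i$, then divide by
  -- $u\cdot w_i$.
  have hlev : u ⬝ᵥ w i ≤ c⁻¹ * (w i ⬝ᵥ w i) := by
    rcases hℓ0.eq_or_lt with h0 | h0
    · rw [← h0]; positivity
    have h1 := dotProduct_sq_le u (w i)
    rw [inv_mul_eq_div, le_div_iff₀ hc]
    refine le_of_mul_le_mul_left ?_ h0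
    calc (u ⬝ᵥ w i) * ((u ⬝ᵥ w i) * c) = c * (u ⬝ᵥ w i) ^ 2 := by ring
      _ ≤ c * ((u ⬝ᵥ u) * (w i ⬝ᵥ w i)) := by gcongr
      _ = (c * (u ⬝ᵥ u)) * (w i ⬝ᵥ w i) := by ring
      _ ≤ _ := by gcongr
  set g := A⁻¹ *ᵥ S
  -- The rank-one update in scalar form. As $u\cdot w_i\ge0$, the factor $1+u\cdot w_i$ can be
  -- discarded in the upper bound.
  have hfit : (w i ⬝ᵥ θ) * (1 + u ⬝ᵥ w i) = g ⬝ᵥ w i + (u ⬝ᵥ w i) * e i := by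
    have h1 : w i ⬝ᵥ θ = w i ⬝ᵥ g + (e i - w i ⬝ᵥ θ) * (w i ⬝ᵥ u) := by
      conv_lhs => rw [hθ]
      rw [dotProduct_add, dotProduct_smul, smul_eq_mul]
    rw [dotProduct_comm (w i) g, dotProduct_comm (w i) u] at h1
    linarith
  calc |w i ⬝ᵥ θ| ≤ |w i ⬝ᵥ θ| * (1 + u ⬝ᵥ w i) := by nlinarith [abs_nonneg (w i ⬝ᵥ θ)]
    _ = |(w i ⬝ᵥ θ) * (1 + u ⬝ᵥ w i)| := by
        rw [abs_mul, abs_of_nonneg (by linarith : 0 ≤ 1 + u ⬝ᵥ w i)]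
    _ ≤ |g ⬝ᵥ w i| + (u ⬝ᵥ w i) * |e i| := by
        rw [hfit]
        refine (abs_add_le _ _).trans ?_
        rw [abs_mul (u ⬝ᵥ w i), abs_of_nonneg hℓ0]
    _ ≤ _ := by
        have : (u ⬝ᵥ w i) * |e i| ≤ c⁻¹ * (w i ⬝ᵥ w i) * |e i| := by gcongr
        linarith

variable {E : Type*} [MeasurableSpace E]

/-- Markov's inequality for the product of a random vector with an independent one. -/
theorem measure_prod_lt_abs_dotProduct_le {G : Type*} [MeasurableSpace G] (P : Measure E)
    [IsProbabilityMeasure P] (π : Measure G) [IsProbabilityMeasure π] {w : E → Fin d → ℝ}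
    (hw : Measurable w) {θ : G → Fin d → ℝ} (hθ : Measurable θ) {p K T : ℝ} (hp : 0 < p)
    (hT : 0 < T) (hwi : ∀ u, Integrable (fun x => |u ⬝ᵥ w x| ^ p) P)
    (hwp : ∀ u, ∫ x, |u ⬝ᵥ w x| ^ p ∂P ≤ (K * √(u ⬝ᵥ u)) ^ p)
    {h : G → ℝ} (hK : 0 ≤ K) (hi : Integrable (fun y => h y ^ p) π)
    (hle : ∀ y, √(θ y ⬝ᵥ θ y) ≤ h y) :
    (P.prod π) {y | T < |θ y.2 ⬝ᵥ w y.1|} ≤ ENNReal.ofReal ((K / T) ^ p * ∫ y, h y ^ p ∂π) := by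
  have hs : MeasurableSet {y : E × G | T < |θ y.2 ⬝ᵥ w y.1|} :=
    measurableSet_lt measurable_const
      (measurable_dotProduct (hθ.comp measurable_snd) (hw.comp measurable_fst)).abs
  have hh0 : ∀ y, 0 ≤ h y := fun y => (Real.sqrt_nonneg _).trans (hle y)
  -- Fubini: the vector `θ y` is frozen, and Markov's inequality is applied in that fixed direction.
  rw [Measure.prod_apply_symm hs, ← integral_const_mul,
    ofReal_integral_eq_lintegral_ofReal (hi.const_mul _)
      (ae_of_all _ fun y => by have := hh0 y; positivity)]
  refine lintegral_mono fun y => ?_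
  have h1 := mul_meas_ge_le_integral_of_nonneg (μ := P) (f := fun x => |θ y ⬝ᵥ w x| ^ p)
    (ae_of_all _ fun x => by positivity) (hwi (θ y)) (T ^ p)
  have hTp : 0 < T ^ p := Real.rpow_pos_of_pos hT p
  have h2 : P.real {x | T ^ p ≤ |θ y ⬝ᵥ w x| ^ p} ≤ (K / T) ^ p * h y ^ p := by
    rw [Real.div_rpow hK hT.le, div_mul_eq_mul_div, le_div_iff₀ hTp, mul_comm]
    refine h1.trans ((hwp _).trans ?_)
    rw [← Real.mul_rpow hK (hh0 y)]
    gcongr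
    exact hle y
  calc P ((fun x => (x, y)) ⁻¹' {y : E × G | T < |θ y.2 ⬝ᵥ w y.1|})
      ≤ P {x | T ^ p ≤ |θ y ⬝ᵥ w x| ^ p} := by
        refine measure_mono fun x hx => ?_
        have hx : T < |θ y ⬝ᵥ w x| := hx
        exact Real.rpow_le_rpow hT.le hx.le hp.le
    _ ≤ _ := by
        rw [ENNReal.le_ofReal_iff_toReal_le (measure_ne_top _ _)
          (by have := hh0 y; positivity)]
        exact h2

end LinReg

namespace LinReg

/-! ### Moment bounds -/

section moments

variable {E : Type*} [MeasurableSpace E]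

/-- `(E|f|^p)^{1/p} ≤ K`, with a finite integral. -/
def MomentLE (P : Measure E) (f : E → ℝ) (p K : ℝ) : Prop :=
  Integrable (fun x => |f x| ^ p) P ∧ ∫ x, |f x| ^ p ∂P ≤ K ^ p

variable {P : Measure E} {f g : E → ℝ} {p q r K L : ℝ}

/-- Integrability is part of `MomentLE` because the integral of a non-integrable function is 0 by
convention; with it the two formulations agree. -/
theorem momentLE_iff (hf : Measurable f) (hp : 0 < p) (hK : 0 ≤ K) :
    MomentLE P f p K ↔ eLpNorm f (ENNReal.ofReal p) P ≤ ENNReal.ofReal K := by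
  have hp0 : ENNReal.ofReal p ≠ 0 := by simpa using hp
  have hpt : (ENNReal.ofReal p).toReal = p := ENNReal.toReal_ofReal hp.le
  have key : MemLp f (ENNReal.ofReal p) P →
      (eLpNorm f (ENNReal.ofReal p) P ≤ ENNReal.ofReal K ↔ ∫ x, |f x| ^ p ∂P ≤ K ^ p) := by
    intro h
    rw [h.eLpNorm_eq_integral_rpow_norm hp0 ENNReal.ofReal_ne_top, hpt,
      ENNReal.ofReal_le_ofReal_iff hK]
    simp only [Real.norm_eq_abs]
    exact Real.rpow_inv_le_iff_of_pos (integral_nonneg fun _ => by positivity) hK hp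
  constructor
  · rintro ⟨h1, h2⟩
    refine (key ?_).2 h2
    rw [← integrable_norm_rpow_iff hf.aestronglyMeasurable hp0 ENNReal.ofReal_ne_top, hpt]
    exact h1
  · intro h
    have hm : MemLp f (ENNReal.ofReal p) P :=
      ⟨hf.aestronglyMeasurable, h.trans_lt ENNReal.ofReal_lt_top⟩
    refine ⟨?_, (key hm).1 h⟩
    have := hm.integrable_norm_rpow hp0 ENNReal.ofReal_ne_top
    rwa [hpt] at this

theorem MomentLE.mul (hf : Measurable f) (hg : Measurable g) (hp : 0 < p) (hq : 0 < q) (hr : 0 < r)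
    (hpqr : 1 / r = 1 / p + 1 / q) (hK : 0 ≤ K) (hL : 0 ≤ L) (h1 : MomentLE P f p K)
    (h2 : MomentLE P g q L) : MomentLE P (fun x => f x * g x) r (K * L) := by
  have h1 := (momentLE_iff hf hp hK).1 h1
  have h2 := (momentLE_iff hg hq hL).1 h2
  have hfg : Measurable fun x => f x * g x := hf.mul hg
  refine (momentLE_iff hfg hr (mul_nonneg hK hL)).2 ?_
  have hpqr' : ENNReal.HolderTriple (ENNReal.ofReal p) (ENNReal.ofReal q) (ENNReal.ofReal r) := by
    constructor
    rw [← ENNReal.ofReal_inv_of_pos hp, ← ENNReal.ofReal_inv_of_pos hq,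
      ← ENNReal.ofReal_inv_of_pos hr, ← ENNReal.ofReal_add (by positivity) (by positivity)]
    congr 1
    simpa using hpqr.symm
  have h3 := eLpNorm_smul_le_mul_eLpNorm (μ := P) hg.aestronglyMeasurable hf.aestronglyMeasurable
    (hpqr := hpqr')
  rw [ENNReal.ofReal_mul hK]
  exact h3.trans (mul_le_mul' h1 h2)

theorem MomentLE.mono_exponent [IsProbabilityMeasure P] (hf : Measurable f) (hr : 0 < r)
    (hrp : r ≤ p) (hK : 0 ≤ K) (h : MomentLE P f p K) : MomentLE P f r K := by
  rw [momentLE_iff hf hr hK]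
  rw [momentLE_iff hf (hr.trans_le hrp) hK] at h
  exact (eLpNorm_le_eLpNorm_of_exponent_le (ENNReal.ofReal_le_ofReal hrp)
    hf.aestronglyMeasurable).trans h

/-- Markov's inequality. -/
theorem MomentLE.measure_lt_le [IsFiniteMeasure P] (hp : 0 < p) (hK : 0 ≤ K) {c : ℝ} (hc : 0 < c)
    (h : MomentLE P f p K) : P {x | c < |f x|} ≤ ENNReal.ofReal ((K / c) ^ p) := by
  have h1 := mul_meas_ge_le_integral_of_nonneg (μ := P) (f := fun x => |f x| ^ p)
    (ae_of_all _ fun x => by positivity) h.1 (c ^ p)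
  have hcp : 0 < c ^ p := Real.rpow_pos_of_pos hc p
  calc P {x | c < |f x|} ≤ P {x | c ^ p ≤ |f x| ^ p} := by
        refine measure_mono fun x hx => ?_
        have hx : c < |f x| := hx
        exact Real.rpow_le_rpow hc.le hx.le hp.le
    _ ≤ _ := by
        rw [ENNReal.le_ofReal_iff_toReal_le (measure_ne_top _ _) (by positivity),
          Real.div_rpow hK hc.le, le_div_iff₀ hcp, mul_comm]
        exact h1.trans h.2

/-- The Euclidean length of a random vector with bounded coordinate moments. -/
theorem momentLE_length {d : ℕ} {w : E → Fin d → ℝ} (hp : 2 ≤ p) (hK : 0 ≤ K)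
    (hw : Measurable w) (h : ∀ a, MomentLE P (fun x => w x a) p K) :
    MomentLE P (fun x => √(w x ⬝ᵥ w x)) p (√d * K) := by
  have hpt : ∀ x, |√(w x ⬝ᵥ w x)| ^ p ≤ (d : ℝ) ^ (p / 2 - 1) * ∑ a, |w x a| ^ p := by
    intro x
    have h0 := dotProduct_self_nonneg (w x)
    have e1 : |√(w x ⬝ᵥ w x)| ^ p = (∑ a, |w x a| ^ 2) ^ (p / 2) := by
      rw [abs_of_nonneg (Real.sqrt_nonneg _), Real.sqrt_eq_rpow, ← Real.rpow_mul h0]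
      simp only [dotProduct, sq_abs]
      simp only [sq]
      congr 1; ring
    rw [e1]
    -- Convexity of the power $p/2\ge1$, applied to the sum of squared coordinates.
    refine (Real.rpow_sum_le_const_mul_sum_rpow_of_nonneg Finset.univ (by linarith)
      fun a _ => by positivity).trans_eq ?_
    simp only [Finset.card_univ, Fintype.card_fin]
    congr 2; ext a
    rw [← Real.rpow_natCast, ← Real.rpow_mul (abs_nonneg _)]
    congr 1; push_cast; ring
  have hi : Integrable (fun x => (d : ℝ) ^ (p / 2 - 1) * ∑ a, |w x a| ^ p) P :=
    (integrable_finsetSum _ fun a _ => (h a).1).const_mul _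
  constructor
  · refine hi.mono' (Measurable.aestronglyMeasurable (by fun_prop)) (ae_of_all _ fun x => ?_)
    rw [Real.norm_of_nonneg (by positivity)]
    exact hpt x
  · rcases Nat.eq_zero_or_pos d with rfl | hd
    · simp [Real.zero_rpow (by linarith : p ≠ 0)]
    have hd' : (0 : ℝ) < d := by exact_mod_cast hd
    calc _ ≤ ∫ x, (d : ℝ) ^ (p / 2 - 1) * ∑ a, |w x a| ^ p ∂P :=
          integral_mono_of_nonneg (ae_of_all _ fun _ => by positivity) hi (ae_of_all _ hpt)
      _ = (d : ℝ) ^ (p / 2 - 1) * ∑ a, ∫ x, |w x a| ^ p ∂P := by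
          rw [integral_const_mul, integral_finsetSum _ fun a _ => (h a).1]
      _ ≤ (d : ℝ) ^ (p / 2 - 1) * ∑ _a : Fin d, K ^ p := by
          gcongr with a; exact (h a).2
      _ = (√d * K) ^ p := by
          rw [Real.mul_rpow (Real.sqrt_nonneg _) hK, Real.sqrt_eq_rpow, ← Real.rpow_mul hd'.le]
          simp only [Finset.sum_const, Finset.card_univ, Fintype.card_fin, nsmul_eq_mul]
          rw [← mul_assoc, Real.rpow_sub_one hd'.ne', div_mul_cancel₀ _ hd'.ne']
          congr 2; ring

end moments

/-! ### Whitening -/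

variable {d : ℕ} {P : Measure ((Fin d → ℝ) × ℝ)} {β : Fin d → ℝ}

/-- The whitened covariate `Σ^{-1/2} X`. -/
noncomputable def whitened (P : Measure ((Fin d → ℝ) × ℝ)) (z : (Fin d → ℝ) × ℝ) : Fin d → ℝ :=
  invSqrtGram P *ᵥ z.1

/-- The error `Y - Xᵀβ`. -/
noncomputable def residual (β : Fin d → ℝ) (z : (Fin d → ℝ) × ℝ) : ℝ := z.2 - z.1 ⬝ᵥ β

theorem measurable_whitened : Measurable (whitened P) := by
  have : Continuous (whitened P) := by unfold whitened; fun_prop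
  exact this.measurable

theorem measurable_residual : Measurable (residual β) :=
  measurable_snd.sub (measurable_dotProduct measurable_fst measurable_const)

theorem IsRegressionLaw.memLp_dotProduct (h : IsRegressionLaw P) (v : Fin d → ℝ) :
    MemLp (fun z : (Fin d → ℝ) × ℝ => v ⬝ᵥ z.1) 2 P := by
  have := memLp_finsetSum Finset.univ fun a _ => (h.memLp_covariate a).const_mul (v a)
  refine this.congr_norm ?_ (ae_of_all _ fun z => ?_)
  · exact (measurable_dotProduct measurable_const measurable_fst).aestronglyMeasurable
  · simp [dotProduct]

theorem IsRegressionLaw.memLp_residual (h : IsRegressionLaw P) (β : Fin d → ℝ) :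
    MemLp (residual β) 2 P := by
  have := h.memLp_response.sub (h.memLp_dotProduct β)
  refine this.congr_norm measurable_residual.aestronglyMeasurable (ae_of_all _ fun z => ?_)
  simp [residual, dotProduct_comm]

theorem IsRegressionLaw.dotProduct_gram (h : IsRegressionLaw P) (v : Fin d → ℝ) :
    v ⬝ᵥ (gram P *ᵥ v) = ∫ z, (v ⬝ᵥ z.1) ^ 2 ∂P := by
  have hi : ∀ a b, Integrable (fun z : (Fin d → ℝ) × ℝ => z.1 a * z.1 b) P := fun a b =>
    (h.memLp_covariate a).integrable_mul (h.memLp_covariate b)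
  have e : ∀ z : (Fin d → ℝ) × ℝ, (v ⬝ᵥ z.1) ^ 2 = ∑ a, ∑ b, v a * v b * (z.1 a * z.1 b) := by
    intro z
    rw [sq, dotProduct, Finset.sum_mul_sum]
    exact Finset.sum_congr rfl fun a _ => Finset.sum_congr rfl fun b _ => by ring
  simp_rw [e]
  rw [integral_finsetSum _ fun a _ => integrable_finsetSum _ fun b _ => (hi a b).const_mul _]
  simp only [dotProduct, Matrix.mulVec, gram, Matrix.of_apply, Finset.mul_sum]
  refine Finset.sum_congr rfl fun a _ => ?_
  rw [integral_finsetSum _ fun b _ => (hi a b).const_mul _]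
  refine Finset.sum_congr rfl fun b _ => ?_
  rw [integral_const_mul]; ring

theorem IsRegressionLaw.posSemidef_gram (h : IsRegressionLaw P) : (gram P).PosSemidef := by
  refine Matrix.PosSemidef.of_dotProduct_mulVec_nonneg ?_ fun v => ?_
  · ext a b; simp [gram, mul_comm]
  · rw [star_trivial, h.dotProduct_gram]
    exact integral_nonneg fun _ => sq_nonneg _

theorem IsRegressionLaw.sqrt_mul_sqrt (h : IsRegressionLaw P) :
    CFC.sqrt (gram P) * CFC.sqrt (gram P) = gram P :=
  CFC.sqrt_mul_sqrt_self _ (Matrix.nonneg_iff_posSemidef.2 h.posSemidef_gram)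

theorem sqrt_gram_transpose : (CFC.sqrt (gram P))ᵀ = CFC.sqrt (gram P) := by
  have := (Matrix.nonneg_iff_posSemidef.1 (CFC.sqrt_nonneg (gram P))).1
  simpa [Matrix.IsHermitian, Matrix.conjTranspose_eq_transpose_of_trivial] using this

theorem invSqrtGram_transpose : (invSqrtGram P)ᵀ = invSqrtGram P := by
  rw [invSqrtGram, Matrix.transpose_nonsing_inv, sqrt_gram_transpose]

theorem IsRegressionLaw.isUnit_det_sqrt (h : IsRegressionLaw P) :
    IsUnit (CFC.sqrt (gram P)).det := by
  have h1 := (Matrix.isUnit_iff_isUnit_det _).1 h.isUnit_gram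
  rw [← h.sqrt_mul_sqrt, Matrix.det_mul] at h1
  exact isUnit_of_mul_isUnit_left h1

theorem dotProduct_whitened (u : Fin d → ℝ) (z : (Fin d → ℝ) × ℝ) :
    u ⬝ᵥ whitened P z = (invSqrtGram P *ᵥ u) ⬝ᵥ z.1 := by
  rw [whitened, Matrix.dotProduct_mulVec, ← Matrix.mulVec_transpose, invSqrtGram_transpose]

theorem IsRegressionLaw.sqrt_mulVec_whitened (h : IsRegressionLaw P) (z : (Fin d → ℝ) × ℝ) :
    CFC.sqrt (gram P) *ᵥ whitened P z = z.1 := by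
  rw [whitened, invSqrtGram, Matrix.mulVec_mulVec, Matrix.mul_nonsing_inv _ h.isUnit_det_sqrt,
    Matrix.one_mulVec]

theorem IsRegressionLaw.whitened_dotProduct_sqrt (h : IsRegressionLaw P) (v : Fin d → ℝ)
    (z : (Fin d → ℝ) × ℝ) : whitened P z ⬝ᵥ (CFC.sqrt (gram P) *ᵥ v) = z.1 ⬝ᵥ v := by
  rw [Matrix.dotProduct_mulVec, ← Matrix.mulVec_transpose, sqrt_gram_transpose,
    h.sqrt_mulVec_whitened]

theorem IsRegressionLaw.isotropic (h : IsRegressionLaw P) (u : Fin d → ℝ) :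
    ∫ z, (u ⬝ᵥ whitened P z) ^ 2 ∂P = u ⬝ᵥ u := by
  simp_rw [dotProduct_whitened]
  rw [← h.dotProduct_gram, ← h.sqrt_mul_sqrt, ← Matrix.mulVec_mulVec]
  have h1 : CFC.sqrt (gram P) *ᵥ (invSqrtGram P *ᵥ u) = u := by
    rw [invSqrtGram, Matrix.mulVec_mulVec, Matrix.mul_nonsing_inv _ h.isUnit_det_sqrt,
      Matrix.one_mulVec]
  rw [h1, Matrix.dotProduct_mulVec, ← Matrix.mulVec_transpose, sqrt_gram_transpose, h1]

/-- The first order condition at a minimum of a quadratic, shared by the population and the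
empirical normal equations. The test point $b/(a+1)$ also covers $a=0$. -/
theorem eq_zero_of_forall_mul_le_sq_mul {a b : ℝ} (ha : 0 ≤ a)
    (key : ∀ t : ℝ, 2 * t * b ≤ t ^ 2 * a) : b = 0 := by
  have h2 := key (b / (a + 1))
  have h3 : 2 * (b / (a + 1)) * b = b ^ 2 * (2 * (a + 1)) / (a + 1) ^ 2 := by field_simp
  have h4 : (b / (a + 1)) ^ 2 * a = b ^ 2 * a / (a + 1) ^ 2 := by field_simp
  rw [h3, h4, div_le_div_iff_of_pos_right (by positivity)] at h2
  have : b ^ 2 = 0 := le_antisymm (by nlinarith [sq_nonneg b]) (sq_nonneg b)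
  exact (pow_eq_zero_iff two_ne_zero).1 this

/-- The population normal equations. -/
theorem IsProjectionParameter.integral_mul_residual (hβ : IsProjectionParameter P β)
    (h : IsRegressionLaw P) (v : Fin d → ℝ) : ∫ z, (v ⬝ᵥ z.1) * residual β z ∂P = 0 := by
  set a := ∫ z, (v ⬝ᵥ z.1) ^ 2 ∂P
  set b := ∫ z, (v ⬝ᵥ z.1) * residual β z ∂P
  have ha : 0 ≤ a := integral_nonneg fun _ => sq_nonneg _
  have i1 := (h.memLp_dotProduct v).integrable_sq
  have i2 := (h.memLp_residual β).integrable_sq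
  have i3 : Integrable (fun z : (Fin d → ℝ) × ℝ => (v ⬝ᵥ z.1) * residual β z) P :=
    (h.memLp_dotProduct v).integrable_mul (h.memLp_residual β)
  have key : ∀ t : ℝ, 2 * t * b ≤ t ^ 2 * a := by
    intro t
    have h1 := hβ (β + t • v)
    have e1 : ∀ z : (Fin d → ℝ) × ℝ, (z.2 - β ⬝ᵥ z.1) ^ 2 = residual β z ^ 2 := fun z => by
      rw [residual, dotProduct_comm]
    have e2 : ∀ z : (Fin d → ℝ) × ℝ, (z.2 - (β + t • v) ⬝ᵥ z.1) ^ 2 =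
        residual β z ^ 2 - 2 * t * ((v ⬝ᵥ z.1) * residual β z) + t ^ 2 * (v ⬝ᵥ z.1) ^ 2 := by
      intro z
      rw [residual, add_dotProduct, smul_dotProduct, smul_eq_mul, dotProduct_comm z.1 β]; ring
    simp_rw [e1, e2] at h1
    rw [integral_add (by exact i2.sub (i3.const_mul _)) (i1.const_mul _),
      integral_sub i2 (i3.const_mul _), integral_const_mul, integral_const_mul] at h1
    linarith
  exact eq_zero_of_forall_mul_le_sq_mul ha key

/-- What the regression assumptions say about the whitened covariate `w` and the error `e`. -/
structure WhitenedModel {E : Type*} [MeasurableSpace E] (P : Measure E) (w : E → Fin d → ℝ)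
    (e : E → ℝ) (qx q Kx Ky : ℝ) : Prop where
  fourth : FourthMoment P w (Kx ^ 4)
  measurable_error : Measurable e
  directional : ∀ u, MomentLE P (fun x => u ⬝ᵥ w x) qx (Kx * √(u ⬝ᵥ u))
  score : MomentLE P (fun x => √(w x ⬝ᵥ w x) * e x) (harm qx q 1 1) (√d * Kx * Ky)
  leverage : MomentLE P (fun x => √(w x ⬝ᵥ w x) * (√(w x ⬝ᵥ w x) * e x)) (harm qx q 2 1)
    (√d * Kx * (√d * Kx * Ky))
  centered : ∀ u, ∫ x, (u ⬝ᵥ w x) * e x ∂P = 0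

theorem CovariateMoment.momentLE {qx Kx : ℝ} (hqx : 0 < qx) (hKx : 0 ≤ Kx)
    (h : CovariateMoment P qx Kx) (u : Fin d → ℝ) :
    MomentLE P (fun z => u ⬝ᵥ whitened P z) qx (Kx * √(u ⬝ᵥ u)) := by
  have hm : Measurable fun z => u ⬝ᵥ whitened P z :=
    measurable_dotProduct measurable_const measurable_whitened
  rw [momentLE_iff hm hqx (by positivity)]
  rcases (dotProduct_self_nonneg u).eq_or_lt with h0 | h0
  · have hu : u = 0 := dotProduct_self_eq_zero.1 h0.symm
    simp [hu]
  set r := √(u ⬝ᵥ u) with hr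
  have hr0 : 0 < r := Real.sqrt_pos.2 h0
  have hr2 : r ^ 2 = u ⬝ᵥ u := Real.sq_sqrt h0.le
  have h1 := h (r⁻¹ • u) (by
    simp only [smul_dotProduct, dotProduct_smul, smul_eq_mul]; rw [← hr2]; field_simp)
  have e : (fun z => u ⬝ᵥ whitened P z) =
      r • fun z : (Fin d → ℝ) × ℝ => (r⁻¹ • u) ⬝ᵥ (invSqrtGram P *ᵥ z.1) := by
    ext z
    simp only [whitened, Pi.smul_apply, smul_dotProduct, smul_eq_mul]
    field_simp
  rw [e, eLpNorm_const_smul, mul_comm Kx, ENNReal.ofReal_mul hr0.le, Real.enorm_of_nonneg hr0.le]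
  gcongr

/-- Hölder's inequality twice: length times error gives the score, and length times score gives the
leverage term. The exponents add as $1/q_x+1/q$ and $2/q_x+1/q$. Centering is the population normal
equation. -/
theorem whitenedModel {qx q Kx Ky : ℝ} (hqx : 4 ≤ qx) (hq : 2 ≤ q) (hKx : 0 ≤ Kx) (hKy : 0 ≤ Ky)
    (h : IsRegressionLaw P) (hβ : IsProjectionParameter P β) (he : ErrorMoment P β q Ky)
    (hx : CovariateMoment P qx Kx) : WhitenedModel P (whitened P) (residual β) qx q Kx Ky := by
  have := h.isProbabilityMeasure
  have hdir := hx.momentLE (by linarith) hKx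
  have hres : MomentLE P (residual β) q Ky :=
    (momentLE_iff measurable_residual (by linarith) hKy).2 he
  have hw := measurable_whitened (P := P)
  have hlen : MomentLE P (fun z => √(whitened P z ⬝ᵥ whitened P z)) qx (√d * Kx) := by
    refine momentLE_length (by linarith) hKx hw fun a => ?_
    simpa using hdir (Pi.single a 1)
  have hlm : Measurable fun z => √(whitened P z ⬝ᵥ whitened P z) := by fun_prop
  have hq0 : 0 < q := by linarith
  have hqx0 : 0 < qx := by linarith
  have hscore : MomentLE P (fun z => √(whitened P z ⬝ᵥ whitened P z) * residual β z)
      (harm qx q 1 1) (√d * Kx * Ky) := by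
    refine MomentLE.mul hlm measurable_residual hqx0 hq0 ?_ ?_ (by positivity) hKy hlen hres
    · unfold harm; positivity
    · simp [harm]
  refine ⟨⟨hw, h.isotropic, ?_, ?_⟩, measurable_residual, hdir, hscore, ?_, ?_⟩
  · intro u
    have h4 := (hdir u).mono_exponent (by fun_prop) (r := 4) (by norm_num) hqx (by positivity)
    refine h4.1.congr (ae_of_all _ fun z => ?_)
    dsimp only
    rw [show (4 : ℝ) = ((4 : ℕ) : ℝ) by norm_num, Real.rpow_natCast, Even.pow_abs (by decide)]
  · intro u
    have h4 := (hdir u).mono_exponent (by fun_prop) (r := 4) (by norm_num) hqx (by positivity)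
    have h5 := h4.2
    simp only [show (4 : ℝ) = ((4 : ℕ) : ℝ) by norm_num, Real.rpow_natCast,
      Even.pow_abs (show Even 4 by decide)] at h5
    refine h5.trans_eq ?_
    rw [mul_pow, show √(u ⬝ᵥ u) ^ 4 = (√(u ⬝ᵥ u) ^ 2) ^ 2 by ring,
      Real.sq_sqrt (dotProduct_self_nonneg u)]
  · refine MomentLE.mul hlm (hlm.mul measurable_residual) hqx0 (q := harm qx q 1 1) ?_ ?_ ?_
      (by positivity) (by positivity) hlen hscore
    · unfold harm; positivity
    · unfold harm; positivity
    · simp only [harm, one_div, inv_inv]; ring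
  · intro u
    simp_rw [dotProduct_whitened]
    exact hβ.integral_mul_residual h _

end LinReg

namespace LinReg

/-! ### The leave-one-out bound -/

section union

variable {E : Type*} [MeasurableSpace E] (P : Measure E) [IsProbabilityMeasure P] {N : ℕ}

/-- For every $i$ the pair (observation $i$, the others) has the same law $P\otimes P^N$, so a union
bound costs exactly the sample size. `B` may be any set, since the splitting is a measurable
equivalence. -/
theorem measure_exists_succAbove_le (B : Set (E × (Fin N → E))) :
    (Measure.pi fun _ : Fin (N + 1) => P) {z | ∃ i, (z i, fun j => z (i.succAbove j)) ∈ B} ≤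
      (N + 1) * (P.prod (Measure.pi fun _ : Fin N => P)) B := by
  have h1 : ∀ i : Fin (N + 1), (Measure.pi fun _ : Fin (N + 1) => P)
      {z | (z i, fun j => z (i.succAbove j)) ∈ B} =
      (P.prod (Measure.pi fun _ : Fin N => P)) B := fun i =>
    (measurePreserving_piFinSuccAbove (fun _ : Fin (N + 1) => P) i).measure_preimage_equiv B
  calc _ ≤ (Measure.pi fun _ : Fin (N + 1) => P)
            (⋃ i, {z | (z i, fun j => z (i.succAbove j)) ∈ B}) := by
        refine measure_mono fun z hz => ?_
        obtain ⟨i, hi⟩ := hz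
        exact Set.mem_iUnion.2 ⟨i, hi⟩
    _ ≤ ∑ i, (Measure.pi fun _ : Fin (N + 1) => P) {z | (z i, fun j => z (i.succAbove j)) ∈ B} :=
        measure_iUnion_fintype_le _ _
    _ = _ := by simp [h1]

theorem measure_exists_apply_le (B : Set E) :
    (Measure.pi fun _ : Fin (N + 1) => P) {z | ∃ i, z i ∈ B} ≤ (N + 1) * P B := by
  have := measure_exists_succAbove_le P (N := N) (B ×ˢ Set.univ)
  simpa [Measure.prod_prod] using this

theorem measure_exists_rest_le (B : Set (Fin N → E)) :
    (Measure.pi fun _ : Fin (N + 1) => P) {z | ∃ i : Fin (N + 1), (fun j => z (i.succAbove j)) ∈ B} ≤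
      (N + 1) * (Measure.pi fun _ : Fin N => P) B := by
  have := measure_exists_succAbove_le P (N := N) (Set.univ ×ˢ B)
  simpa [Measure.prod_prod] using this

end union

theorem natCast_add_one_mul_le_ofReal {N : ℕ} {m : ENNReal} {x y : ℝ} (hm : m ≤ ENNReal.ofReal x)
    (hxy : (N + 1) * x ≤ y) : (N + 1 : ENNReal) * m ≤ ENNReal.ofReal y := by
  calc (N + 1 : ENNReal) * m ≤ ENNReal.ofReal (N + 1) * ENNReal.ofReal x := by
        rw [ENNReal.ofReal_add (by positivity) (by norm_num)]
        simp only [ENNReal.ofReal_natCast, ENNReal.ofReal_one]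
        gcongr
    _ = ENNReal.ofReal ((N + 1) * x) := (ENNReal.ofReal_mul (by positivity)).symm
    _ ≤ _ := ENNReal.ofReal_le_ofReal hxy

/-- The score vector `w e` as an element of Euclidean space. -/
noncomputable def scoreVector {E : Type*} {d : ℕ} (w : E → Fin d → ℝ) (e : E → ℝ) (x : E) :
    EuclideanSpace ℝ (Fin d) :=
  WithLp.toLp 2 (e x • w x)

variable {d : ℕ}

theorem norm_toLp_eq_sqrt (v : Fin d → ℝ) : ‖WithLp.toLp 2 v‖ = √(v ⬝ᵥ v) := by
  rw [EuclideanSpace.norm_eq]; simp [dotProduct, sq]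

theorem norm_scoreVector {E : Type*} (w : E → Fin d → ℝ) (e : E → ℝ) (x : E) :
    ‖scoreVector w e x‖ = |√(w x ⬝ᵥ w x) * e x| := by
  rw [scoreVector, WithLp.toLp_smul, norm_smul, norm_toLp_eq_sqrt, abs_mul,
    abs_of_nonneg (Real.sqrt_nonneg _), mul_comm, Real.norm_eq_abs]

/-! ### Truncated scores and the resulting leave-one-out solutions -/

section

variable {E : Type*}

/-- The sum of the score vectors truncated at norm `M`. -/
noncomputable def truncScoreSum {N : ℕ} (M : ℝ) (w : E → Fin d → ℝ) (e : E → ℝ) (z : Fin N → E) :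
    EuclideanSpace ℝ (Fin d) :=
  ∑ j, truncNorm M (scoreVector w e (z j))

/-- The solution of the normal equations for the truncated scores. -/
noncomputable def truncSolution {N : ℕ} (c M : ℝ) (w : E → Fin d → ℝ) (e : E → ℝ) (z : Fin N → E) :
    Fin d → ℝ :=
  normalSolution c (fun j => w (z j)) (truncScoreSum M w e z).ofLp

theorem norm_truncScoreSum_le {N : ℕ} {M : ℝ} (hM : 0 ≤ M) (w : E → Fin d → ℝ) (e : E → ℝ)
    (z : Fin N → E) : ‖truncScoreSum M w e z‖ ≤ N * M := by
  refine (norm_sum_le _ _).trans ?_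
  simpa using Finset.sum_le_sum fun j (_ : j ∈ Finset.univ) =>
    norm_truncNorm_le hM (scoreVector w e (z j))

theorem ofLp_truncScoreSum {N : ℕ} {M : ℝ} {w : E → Fin d → ℝ} {e : E → ℝ} {z : Fin N → E}
    (h : ∀ j, |√(w (z j) ⬝ᵥ w (z j)) * e (z j)| ≤ M) :
    (truncScoreSum M w e z).ofLp = ∑ j, e (z j) • w (z j) := by
  rw [truncScoreSum, WithLp.ofLp_sum]
  refine Finset.sum_congr rfl fun j _ => ?_
  rw [truncNorm_of_le (by rw [norm_scoreVector]; exact h j), scoreVector]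

theorem sqrt_truncSolution_le {N : ℕ} {c : ℝ} (hc : 0 < c) (M : ℝ) (w : E → Fin d → ℝ) (e : E → ℝ)
    (z : Fin N → E) :
    √(truncSolution c M w e z ⬝ᵥ truncSolution c M w e z) ≤ c⁻¹ * ‖truncScoreSum M w e z‖ := by
  have h1 := normalSolution_le c (fun j => w (z j)) (truncScoreSum M w e z).ofLp
  have h2 : ‖truncScoreSum M w e z‖ =
      √((truncScoreSum M w e z).ofLp ⬝ᵥ (truncScoreSum M w e z).ofLp) := by
    rw [← norm_toLp_eq_sqrt, WithLp.toLp_ofLp]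
  refine Real.sqrt_le_iff.2 ⟨by positivity, ?_⟩
  rw [mul_pow, h2, Real.sq_sqrt (dotProduct_self_nonneg _), inv_pow, ← div_eq_inv_mul,
    le_div_iff₀ (by positivity), mul_comm]
  exact h1

end

variable {E : Type*} [MeasurableSpace E] {P : Measure E}
  {w : E → Fin d → ℝ} {e : E → ℝ} {qx q Kx Ky : ℝ}

theorem WhitenedModel.measurable_scoreVector (h : WhitenedModel P w e qx q Kx Ky) :
    Measurable (scoreVector w e) :=
  (WithLp.measurable_toLp 2 _).comp (h.measurable_error.smul h.fourth.measurable)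

theorem WhitenedModel.integral_scoreVector [IsProbabilityMeasure P]
    (h : WhitenedModel P w e qx q Kx Ky)
    (hs : 1 ≤ harm qx q 1 1) (hKx : 0 ≤ Kx) (hKy : 0 ≤ Ky) : ∫ x, scoreVector w e x ∂P = 0 := by
  have hw := h.fourth.measurable
  have he := h.measurable_error
  have h1 := (h.score.mono_exponent (by fun_prop) one_pos hs (by positivity)).1
  have hi : Integrable (scoreVector w e) P := by
    refine h1.mono' h.measurable_scoreVector.aestronglyMeasurable (ae_of_all _ fun x => ?_)
    rw [norm_scoreVector, Real.rpow_one]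
  refine ext_inner_left ℝ fun u => ?_
  rw [← integral_inner hi, inner_zero_right, ← h.centered u.ofLp]
  refine integral_congr_ae (ae_of_all _ fun x => ?_)
  dsimp only
  rw [scoreVector, ← WithLp.toLp_ofLp 2 u, EuclideanSpace.inner_toLp_toLp]
  simp [dotProduct_comm, mul_comm]

theorem WhitenedModel.measurable_truncScoreSum (h : WhitenedModel P w e qx q Kx Ky) (N : ℕ) (M : ℝ) :
    Measurable (truncScoreSum M w e : (Fin N → E) → _) :=
  Finset.measurable_sum _ fun j _ =>
    (measurable_truncNorm M).comp (h.measurable_scoreVector.comp (measurable_pi_apply j))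

theorem WhitenedModel.measurable_truncSolution (h : WhitenedModel P w e qx q Kx Ky) (N : ℕ)
    (c M : ℝ) : Measurable (truncSolution c M w e : (Fin N → E) → _) := by
  have h1 : Measurable fun z : Fin N → E => fun j => w (z j) :=
    measurable_pi_lambda _ fun j => h.fourth.measurable.comp (measurable_pi_apply j)
  have h2 : Measurable fun z : Fin N → E => (truncScoreSum M w e z).ofLp :=
    (WithLp.measurable_ofLp 2 _).comp (h.measurable_truncScoreSum N M)
  have h3 := h1.prodMk h2
  have h4 := measurable_normalSolution (d := d) (N := N) c
  have h5 := h4.comp h3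
  exact h5

/-- The fit at an observation of a solution computed from the other observations. -/
theorem WhitenedModel.measure_prod_truncSolution_le [IsProbabilityMeasure P]
    (h : WhitenedModel P w e qx q Kx Ky) (hqx : 0 < qx) (hKx : 0 < Kx) {N : ℕ} {c M D ℓ : ℝ}
    (hc : 0 < c) (hM : 0 ≤ M) (hD : 0 < D) (hℓ : 0 < ℓ)
    (hS : ∫ z, ‖truncScoreSum M w e z‖ ^ qx ∂(Measure.pi fun _ : Fin N => P) ≤ D ^ qx) :
    (P.prod (Measure.pi fun _ : Fin N => P))
      {y | c⁻¹ * D * Kx * ℓ ^ (1 / qx) < |truncSolution c M w e y.2 ⬝ᵥ w y.1|} ≤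
      ENNReal.ofReal ℓ⁻¹ := by
  have hm := h.measurable_truncScoreSum N M
  have hi : Integrable (fun z : Fin N → E => (c⁻¹ * ‖truncScoreSum M w e z‖) ^ qx)
      (Measure.pi fun _ : Fin N => P) := by
    refine integrable_of_bounded (by fun_prop) (B := (c⁻¹ * (N * M)) ^ qx) fun z => ?_
    rw [abs_of_nonneg (by positivity)]
    gcongr
    exact norm_truncScoreSum_le hM w e z
  have hℓ' : 0 < ℓ ^ (1 / qx) := by positivity
  refine (measure_prod_lt_abs_dotProduct_le P _ h.fourth.measurable
    (h.measurable_truncSolution N c M) hqx (by positivity) (fun u => (h.directional u).1)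
    (fun u => (h.directional u).2) hKx.le hi (sqrt_truncSolution_le hc M w e)).trans
    (ENNReal.ofReal_le_ofReal ?_)
  have h1 : ∫ z, (c⁻¹ * ‖truncScoreSum M w e z‖) ^ qx ∂(Measure.pi fun _ : Fin N => P) ≤
      (c⁻¹ * D) ^ qx := by
    simp_rw [Real.mul_rpow (show 0 ≤ c⁻¹ by positivity) (norm_nonneg _)]
    rw [integral_const_mul, Real.mul_rpow (by positivity) hD.le]
    gcongr
  refine (mul_le_mul_of_nonneg_left h1 (by positivity)).trans_eq ?_
  rw [← Real.mul_rpow (by positivity) (by positivity)]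
  have e1 : Kx / (c⁻¹ * D * Kx * ℓ ^ (1 / qx)) * (c⁻¹ * D) = (ℓ ^ (1 / qx))⁻¹ := by field_simp
  rw [e1, Real.inv_rpow hℓ'.le, ← Real.rpow_mul hℓ.le, one_div_mul_cancel hqx.ne', Real.rpow_one]

set_option maxHeartbeats 1000000 in
/-- **Leave-one-out bound** for all solutions of the empirical normal equations. -/
theorem exists_measure_fitted_le {qx : ℝ} (hqx : 4 ≤ qx) : ∃ C : ℝ, 1 ≤ C ∧
    ∀ {E : Type*} [MeasurableSpace E] {P : Measure E} [IsProbabilityMeasure P] {d : ℕ}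
      {w : E → Fin d → ℝ} {e : E → ℝ} {q Kx Ky : ℝ} (_ : 0 < d) (_ : WhitenedModel P w e qx q Kx Ky)
      (_ : 0 < q) (_ : 2 ≤ harm qx q 1 1) (_ : 1 ≤ Kx) (_ : 0 < Ky) {N : ℕ} {δ₀ δ₁ δ₂ : ℝ}
      (_ : 0 < δ₀) (_ : δ₀ ≤ 1) (_ : 0 < δ₁) (_ : δ₁ ≤ 1) (_ : 0 < δ₂)
      (_ : 80 * Kx ^ 4 * (d + 2 * Real.log ((N + 1) / δ₀)) ≤ N),
      (Measure.pi fun _ : Fin (N + 1) => P) {z | ¬ ∀ θ : Fin d → ℝ,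
        ∑ j, (e (z j) - w (z j) ⬝ᵥ θ) • w (z j) = 0 → ∀ i, |w (z i) ⬝ᵥ θ| ≤
          4 / (N + 1) * (C * (√d * Kx * Ky * ((N + 1 : ℝ) ^ (1 / 2 : ℝ)
            + ((N + 1) / (2 * (N + 1) / δ₁)) ^ (1 / qx)
              * (2 * (N + 1) / δ₁) ^ (1 / harm qx q 1 1)))) * Kx * (2 * (N + 1) / δ₁) ^ (1 / qx)
          + 4 / (N + 1) * (√d * Kx * (√d * Kx * Ky) * ((N + 1) / δ₂) ^ (1 / harm qx q 2 1))} ≤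
        ENNReal.ofReal (δ₀ + δ₁ + δ₂) := by
  obtain ⟨C, hC, hsum⟩ := exists_integral_truncNorm_sum_le hqx
  refine ⟨C, hC, ?_⟩
  intro E _ P _ d w e q Kx Ky hd h hq hs2 hKx hKy N δ₀ δ₁ δ₂ hδ₀ hδ₀' hδ₁ hδ₁' hδ₂ hN
  have hd' : (0 : ℝ) < d := by exact_mod_cast hd
  have hqx0 : 0 < qx := by linarith
  have hKx0 : 0 < Kx := by linarith
  have hw := h.fourth.measurable
  have he := h.measurable_error
  set n : ℝ := N + 1 with hn
  have hn1 : 1 ≤ n := by rw [hn]; linarith [(Nat.cast_nonneg N : (0 : ℝ) ≤ N)]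
  have hn0 : 0 < n := by linarith
  -- The budget `δ₁` is shared equally by two events, large scores and large fits: a union over $n$
  -- indices of probability $1/\ell$ costs $\delta_1/2$.
  set ℓ := 2 * n / δ₁ with hℓ
  have hnℓ : n ≤ ℓ := by rw [hℓ, le_div_iff₀ hδ₁]; nlinarith
  have hℓ0 : 0 < ℓ := by positivity
  set s := harm qx q 1 1 with hs
  set r := harm qx q 2 1 with hr
  have hs0 : 0 < s := by linarith
  have hr0 : 0 < r := by rw [hr]; unfold harm; positivity
  have hsqx : s ≤ qx := by
    rw [hs]; unfold harm
    rw [inv_le_comm₀ (by positivity) hqx0, ← one_div]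
    have : 0 < 1 / q := by positivity
    linarith
  set A := √d * Kx * Ky with hA
  have hA0 : 0 < A := by have := Real.sqrt_pos.2 hd'; positivity
  -- Markov's inequality for the fits needs moments of order `qx` of the score sum, but scores have
  -- only $s\le q_x$ of them. Truncation bridges the gap, at a level each score exceeds with
  -- probability at most $1/\ell$.
  set M := A * ℓ ^ (1 / s) with hM
  have hM0 : 0 < M := by positivity
  set D := C * (A * (n ^ (1 / 2 : ℝ) + (n / ℓ) ^ (1 / qx) * ℓ ^ (1 / s))) with hD
  have hD0 : 0 < D := by positivity
  set T := 4 / n * D * Kx * ℓ ^ (1 / qx) with hT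
  have hT0 : 0 < T := by positivity
  set A₂ := √d * Kx * A with hA₂
  have hA₂0 : 0 < A₂ := by have := Real.sqrt_pos.2 hd'; positivity
  set T₂ := A₂ * (n / δ₂) ^ (1 / r) with hT₂
  have hT₂0 : 0 < T₂ := by positivity
  set π := Measure.pi fun _ : Fin (N + 1) => P
  set πN := Measure.pi fun _ : Fin N => P with hπN
  -- The lower bound for the Gram matrix of the $N$ remaining observations is already normalized by
  -- the full sample size $n=N+1$.
  set c := n / 4 with hc
  have hc0 : 0 < c := by positivity
  -- the four exceptional sets
  set B₀ : Set (Fin N → E) :=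
    {z | ¬ ∀ v : Fin d → ℝ, c * (v ⬝ᵥ v) ≤ ∑ j, (v ⬝ᵥ w (z j)) ^ 2}
  set B₁ : Set E := {x | M < |√(w x ⬝ᵥ w x) * e x|}
  set B₁' : Set (E × (Fin N → E)) := {y | T < |truncSolution c M w e y.2 ⬝ᵥ w y.1|}
  set B₂ : Set E := {x | T₂ < |√(w x ⬝ᵥ w x) * (√(w x ⬝ᵥ w x) * e x)|}
  have hpow : ∀ {a c t : ℝ}, 0 < a → 0 < c → 0 < t → (a / (a * c ^ (1 / t))) ^ t = c⁻¹ := by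
    intro a c t ha hc ht
    have : 0 < c ^ (1 / t) := by positivity
    rw [← div_div, div_self ha.ne', one_div, Real.inv_rpow this.le, ← Real.rpow_mul hc.le,
      one_div_mul_cancel ht.ne', Real.rpow_one]
  have hB₀ : πN B₀ ≤ ENNReal.ofReal (δ₀ / n) := by
    have hL : 0 ≤ Real.log (n / δ₀) := Real.log_nonneg (by rw [le_div_iff₀ hδ₀]; linarith)
    have := h.fourth.measure_sum_dotProduct_sq_lt_le (one_le_pow₀ hKx) hd hL hN
    rwa [Real.exp_neg, Real.exp_log (by positivity), inv_div] at this
  have hB₁ : P B₁ ≤ ENNReal.ofReal ℓ⁻¹ := by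
    have := h.score.measure_lt_le hs0 hA0.le hM0
    rwa [hM, hpow hA0 hℓ0 hs0] at this
  have hB₂ : P B₂ ≤ ENNReal.ofReal (n / δ₂)⁻¹ := by
    have := h.leverage.measure_lt_le hr0 hA₂0.le hT₂0
    rwa [hT₂, hpow hA₂0 (by positivity) hr0] at this
  have hSp : ∫ z, ‖truncScoreSum M w e z‖ ^ qx ∂πN ≤ D ^ qx := by
    refine hsum P (scoreVector w e) h.measurable_scoreVector s A hs2 hsqx hA0 ?_ ?_
      (h.integral_scoreVector (by linarith) hKx0.le hKy.le) n ℓ hn1 hnℓ N (by linarith)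
    · simp_rw [norm_scoreVector]; exact h.score.1
    · simp_rw [norm_scoreVector]; exact h.score.2
  have hB₁' : (P.prod πN) B₁' ≤ ENNReal.ofReal ℓ⁻¹ := by
    have := h.measure_prod_truncSolution_le hqx0 hKx0 hc0 hM0.le hD0 hℓ0 hSp
    rwa [hc, inv_div] at this
  have hsub : {z : Fin (N + 1) → E | ¬ ∀ θ : Fin d → ℝ,
        ∑ j, (e (z j) - w (z j) ⬝ᵥ θ) • w (z j) = 0 → ∀ i, |w (z i) ⬝ᵥ θ| ≤ T + 4 / n * T₂} ⊆
      (({z | ∃ i : Fin (N + 1), (fun j => z (i.succAbove j)) ∈ B₀} ∪ {z | ∃ i, z i ∈ B₁}) ∪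
        {z | ∃ i, (z i, fun j => z (i.succAbove j)) ∈ B₁'}) ∪ {z | ∃ i, z i ∈ B₂} := by
    intro z hz
    by_contra hcon
    simp only [Set.mem_union, not_or] at hcon
    obtain ⟨⟨⟨h0, h1⟩, h1'⟩, h2⟩ := hcon
    refine hz fun θ hθ i => ?_
    have g0 : ∀ v : Fin d → ℝ, c * (v ⬝ᵥ v) ≤ ∑ j, (v ⬝ᵥ w (z (i.succAbove j))) ^ 2 := by
      by_contra hc; exact h0 ⟨i, hc⟩
    have g1 : ∀ j, |√(w (z j) ⬝ᵥ w (z j)) * e (z j)| ≤ M := fun j => by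
      by_contra hc; exact h1 ⟨j, not_le.1 hc⟩
    have g1' : |truncSolution c M w e (fun j => z (i.succAbove j)) ⬝ᵥ w (z i)| ≤ T := by
      by_contra hc; exact h1' ⟨i, not_le.1 hc⟩
    have g2 : |√(w (z i) ⬝ᵥ w (z i)) * (√(w (z i) ⬝ᵥ w (z i)) * e (z i))| ≤ T₂ := by
      by_contra hc; exact h2 ⟨i, not_le.1 hc⟩
    have hfit := abs_fitted_le (w := fun j => w (z j)) (e := fun j => e (z j)) hθ i
      hc0 g0
    -- No score exceeds `M` on this event, so the truncated sum is the true one.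
    have hSeq := ofLp_truncScoreSum (z := fun j => z (i.succAbove j)) fun j => g1 (i.succAbove j)
    rw [← hSeq] at hfit
    refine hfit.trans (add_le_add g1' ?_)
    rw [hc, inv_div]
    gcongr
    refine le_of_eq_of_le ?_ g2
    rw [← mul_assoc, Real.mul_self_sqrt (dotProduct_self_nonneg _), abs_mul,
      abs_of_nonneg (dotProduct_self_nonneg (w (z i)))]
  have hnℓ' : (N + 1) * ℓ⁻¹ ≤ δ₁ / 2 := by
    rw [← hn, hℓ, inv_div]; exact le_of_eq (by field_simp)
  refine (measure_mono hsub).trans ?_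
  calc _ ≤ ENNReal.ofReal δ₀ + ENNReal.ofReal (δ₁ / 2) + ENNReal.ofReal (δ₁ / 2)
        + ENNReal.ofReal δ₂ := by
        refine (measure_union_le _ _).trans (add_le_add ((measure_union_le _ _).trans
          (add_le_add ((measure_union_le _ _).trans (add_le_add ?_ ?_)) ?_)) ?_)
        · exact (measure_exists_rest_le P B₀).trans (natCast_add_one_mul_le_ofReal hB₀
            (le_of_eq (by rw [← hn]; field_simp)))
        · exact (measure_exists_apply_le P B₁).trans (natCast_add_one_mul_le_ofReal hB₁ hnℓ')
        · exact (measure_exists_succAbove_le P B₁').trans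
            (natCast_add_one_mul_le_ofReal hB₁' hnℓ')
        · exact (measure_exists_apply_le P B₂).trans (natCast_add_one_mul_le_ofReal hB₂
            (le_of_eq (by rw [← hn]; field_simp)))
    _ = ENNReal.ofReal (δ₀ + δ₁ + δ₂) := by
        rw [← ENNReal.ofReal_add hδ₀.le (by positivity),
          ← ENNReal.ofReal_add (by positivity) (by positivity),
          ← ENNReal.ofReal_add (by positivity) hδ₂.le]
        congr 1; ring

end LinReg

namespace LinReg

/-! ### Least squares estimates and the final rate -/

/-- The empirical normal equations. -/
theorem IsLeastSquares.sum_smul_eq_zero {n d : ℕ} {x : Fin n → Fin d → ℝ} {y : Fin n → ℝ}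
    {b : Fin d → ℝ} (h : IsLeastSquares x y b) : ∑ j, (y j - x j ⬝ᵥ b) • x j = 0 := by
  rcases Nat.eq_zero_or_pos n with rfl | hn
  · simp
  have hn' : (0 : ℝ) < n := by exact_mod_cast hn
  have key : ∀ v : Fin d → ℝ, ∑ j, (y j - x j ⬝ᵥ b) * (v ⬝ᵥ x j) = 0 := by
    intro v
    refine eq_zero_of_forall_mul_le_sq_mul (a := ∑ j, (v ⬝ᵥ x j) ^ 2) (by positivity) fun t => ?_
    have h1 := le_of_mul_le_mul_left (h (b + t • v)) (by positivity)
    have e : ∑ j, (y j - (b + t • v) ⬝ᵥ x j) ^ 2 = ∑ j, (y j - b ⬝ᵥ x j) ^ 2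
        - 2 * t * ∑ j, (y j - x j ⬝ᵥ b) * (v ⬝ᵥ x j) + t ^ 2 * ∑ j, (v ⬝ᵥ x j) ^ 2 := by
      rw [Finset.mul_sum, Finset.mul_sum, ← Finset.sum_sub_distrib, ← Finset.sum_add_distrib]
      refine Finset.sum_congr rfl fun j _ => ?_
      rw [add_dotProduct, smul_dotProduct, smul_eq_mul, dotProduct_comm (x j) b]; ring
    linarith
  refine dotProduct_self_eq_zero.1 ?_
  have h1 := key (∑ j, (y j - x j ⬝ᵥ b) • x j)
  rw [dotProduct_sum]
  simpa [dotProduct_smul] using h1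

/-- The normal equations multiplied by $\Sigma^{-1/2}$, in the coordinates
$\theta=\Sigma^{1/2}(b-\beta)$ that preserve fitted values. -/
theorem IsLeastSquares.whitened_normal {n d : ℕ} {P : Measure ((Fin d → ℝ) × ℝ)}
    (hP : IsRegressionLaw P) {z : Fin n → (Fin d → ℝ) × ℝ} {b : Fin d → ℝ}
    (h : IsLeastSquares (fun i => (z i).1) (fun i => (z i).2) b) (β : Fin d → ℝ) :
    ∑ j, (residual β (z j) - whitened P (z j) ⬝ᵥ (CFC.sqrt (gram P) *ᵥ (b - β)))
      • whitened P (z j) = 0 := by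
  have h1 := congrArg (invSqrtGram P *ᵥ ·) h.sum_smul_eq_zero
  simp only [Matrix.mulVec_sum, Matrix.mulVec_smul, Matrix.mulVec_zero] at h1
  refine Eq.trans (Finset.sum_congr rfl fun j _ => ?_) h1
  rw [hP.whitened_dotProduct_sqrt, residual, dotProduct_sub, whitened]
  congr 1; ring

/-- Squaring $9K_x^2\sqrt{x/n}<1$ gives $81K_x^4x\le n$. Passing from 81 to 80 frees $K_x^4x\ge1$,
which pays for the deleted observation. -/
theorem sample_size_of_gramFactor_pos {N d : ℕ} {Kx δ₀ : ℝ} (hd : 0 < d) (hKx : 1 ≤ Kx)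
    (hδ₀ : 0 < δ₀) (hδ₀' : δ₀ ≤ 1) (h : 0 < gramFactor (N + 1) d Kx δ₀) :
    80 * Kx ^ 4 * (d + 2 * Real.log ((N + 1) / δ₀)) ≤ N := by
  unfold gramFactor at h
  push_cast at h
  set n : ℝ := N + 1 with hn
  have hn1 : 1 ≤ n := by rw [hn]; linarith [(Nat.cast_nonneg N : (0 : ℝ) ≤ N)]
  have hd' : (1 : ℝ) ≤ d := by exact_mod_cast hd
  have hlog0 : 0 ≤ Real.log (n / δ₀) := Real.log_nonneg (by rw [le_div_iff₀ hδ₀]; linarith)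
  have hlog : Real.log (n / δ₀) ≤ Real.log (2 * n / δ₀) := by
    refine Real.log_le_log (by positivity) ?_
    gcongr; linarith
  set x := d + 2 * Real.log (2 * n / δ₀) with hx
  have hx1 : 1 ≤ x := by linarith
  have hsq := Real.sq_sqrt (show 0 ≤ x / n by positivity)
  have h0 := Real.sqrt_nonneg (x / n)
  have h1 : (9 * Kx ^ 2 * √(x / n)) ^ 2 ≤ 1 :=
    pow_le_one₀ (by positivity) (by linarith)
  have h2 : 81 * Kx ^ 4 * x ≤ n := by
    have e : (9 * Kx ^ 2 * √(x / n)) ^ 2 = 81 * Kx ^ 4 * x / n := by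
      rw [mul_pow, hsq]; ring
    rwa [e, div_le_one (by linarith)] at h1
  have h3 : 1 ≤ Kx ^ 4 * x := one_le_mul_of_one_le_of_one_le (one_le_pow₀ hKx) hx1
  have h4 : 80 * Kx ^ 4 * (d + 2 * Real.log (n / δ₀)) ≤ 80 * Kx ^ 4 * x := by
    refine mul_le_mul_of_nonneg_left ?_ (by positivity)
    linarith
  linarith

/-- Write $a=1/q_x$, $b=1/q$. Since $(n/\ell)^a\ell^a=n^a$, the heavy-tail part carries only
$\delta_1^{-(a+b)}n^{2a+b-1}$; the rate allows $\delta_1^{-(2a+b)}n^{3a+2b-1}$, which is larger as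
$\delta_1\le1\le n$. The constant 8 is 4 times the factor $2^c\le2$ in $\ell^c$. -/
theorem bound_le_rate {N d : ℕ} {qx q Kx Ky C δ₁ δ₂ : ℝ} (hqx : 4 ≤ qx) (hq : 2 ≤ q)
    (hKx : 1 ≤ Kx) (hKy : 0 < Ky) (hC : 1 ≤ C) (hδ₁ : 0 < δ₁) (hδ₁' : δ₁ ≤ 1) (hδ₂ : 0 < δ₂) :
    4 / (N + 1) * (C * (√d * Kx * Ky * ((N + 1 : ℝ) ^ (1 / 2 : ℝ)
            + ((N + 1) / (2 * (N + 1) / δ₁)) ^ (1 / qx)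
              * (2 * (N + 1) / δ₁) ^ (1 / harm qx q 1 1)))) * Kx * (2 * (N + 1) / δ₁) ^ (1 / qx)
          + 4 / (N + 1) * (√d * Kx * (√d * Kx * Ky) * ((N + 1) / δ₂) ^ (1 / harm qx q 2 1)) ≤
      8 * C * Kx ^ 2 * Ky * rate (N + 1) d qx q δ₁ δ₂ := by
  unfold rate
  push_cast
  set n : ℝ := N + 1 with hn
  have hn1 : 1 ≤ n := by rw [hn]; linarith [(Nat.cast_nonneg N : (0 : ℝ) ≤ N)]
  have hn0 : 0 < n := by linarith
  have hqx0 : 0 < qx := by linarith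
  have hq0 : 0 < q := by linarith
  set ℓ := 2 * n / δ₁ with hℓ
  have hℓ0 : 0 < ℓ := by positivity
  have e11 : 1 / harm qx q 1 1 = 1 / qx + 1 / q := by simp [harm]
  have e21 : 1 / harm qx q 2 1 = 2 / qx + 1 / q := by simp [harm]
  have e32 : 1 / harm qx q 3 2 = 3 / qx + 2 / q := by simp [harm]
  rw [e11, e21, e32]
  set a := 1 / qx with ha
  set b := 1 / q with hb
  have ha0 : 0 < a := by positivity
  have hb0 : 0 < b := by positivity
  have ha4 : a ≤ 1 / 4 := one_div_le_one_div_of_le (by norm_num) hqx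
  have hb2 : b ≤ 1 / 2 := one_div_le_one_div_of_le (by norm_num) hq
  rw [show 2 / qx = 2 * a by rw [ha]; ring, show 3 / qx = 3 * a by rw [ha]; ring,
    show 2 / q = 2 * b by rw [hb]; ring]
  have hsd : √(d : ℝ) * √(d : ℝ) = d := Real.mul_self_sqrt (Nat.cast_nonneg d)
  have hsd0 := Real.sqrt_nonneg (d : ℝ)
  have hδinv : ∀ c : ℝ, (n / δ₁) ^ c = n ^ c / δ₁ ^ c := fun c => Real.div_rpow hn0.le hδ₁.le c
  have hℓle : ∀ c : ℝ, 0 ≤ c → c ≤ 1 → ℓ ^ c ≤ 2 * (n ^ c / δ₁ ^ c) := by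
    intro c hc0 hc1
    rw [hℓ, mul_div_assoc, Real.mul_rpow (by norm_num) (by positivity), hδinv]
    gcongr
    calc (2 : ℝ) ^ c ≤ 2 ^ (1 : ℝ) := Real.rpow_le_rpow_of_exponent_le (by norm_num) hc1
      _ = 2 := Real.rpow_one 2
  -- the first term
  have t1 : √d * (n ^ (1 / 2 : ℝ) / n * (n ^ a / δ₁ ^ a)) ≤
      √((d + Real.log (2 * n / δ₁)) / (δ₁ ^ (2 * a) * n ^ (1 - 2 * a))) := by
    refine Real.le_sqrt_of_sq_le ?_
    have hlog : 0 ≤ Real.log (2 * n / δ₁) :=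
      Real.log_nonneg (by rw [le_div_iff₀ hδ₁]; linarith)
    have hsq : ∀ {x : ℝ} (c : ℝ), 0 < x → (x ^ c) ^ 2 = x ^ (2 * c) := fun c hx => by
      rw [← Real.rpow_natCast, ← Real.rpow_mul hx.le]; congr 1; push_cast; ring
    have e : (√d * (n ^ (1 / 2 : ℝ) / n * (n ^ a / δ₁ ^ a))) ^ 2 =
        d / (δ₁ ^ (2 * a) * n ^ (1 - 2 * a)) := by
      rw [mul_pow, mul_pow, div_pow, div_pow, hsq _ hn0, hsq _ hn0, hsq _ hδ₁,
        Real.sq_sqrt (Nat.cast_nonneg d), Real.rpow_sub hn0, Real.rpow_one]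
      norm_num
      have : 0 < n ^ (2 * a) := by positivity
      have : 0 < δ₁ ^ (2 * a) := by positivity
      field_simp
    rw [e]
    gcongr
    linarith
  -- the second term
  have t2 : √d * (n ^ a / n * (n ^ (a + b) / δ₁ ^ (a + b))) ≤
      √d / (δ₁ ^ (2 * a + b) * n ^ (1 - (3 * a + 2 * b))) := by
    have e : √d * (n ^ a / n * (n ^ (a + b) / δ₁ ^ (a + b))) =
        √d / (δ₁ ^ (a + b) * n ^ (1 - (a + (a + b)))) := by
      rw [Real.rpow_sub hn0, Real.rpow_one, Real.rpow_add hn0 a (a + b)]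
      have : 0 < n ^ a := by positivity
      have : 0 < n ^ (a + b) := by positivity
      have : 0 < δ₁ ^ (a + b) := by positivity
      field_simp
    rw [e]
    have h1 : δ₁ ^ (2 * a + b) ≤ δ₁ ^ (a + b) :=
      Real.rpow_le_rpow_of_exponent_ge hδ₁ hδ₁' (by linarith)
    have h2 : n ^ (1 - (3 * a + 2 * b)) ≤ n ^ (1 - (a + (a + b))) :=
      Real.rpow_le_rpow_of_exponent_le hn1 (by linarith)
    gcongr
  -- the third term
  have t3 : 4 / n * (√d * Kx * (√d * Kx * Ky) * (n / δ₂) ^ (2 * a + b)) =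
      4 * Kx ^ 2 * Ky * (d / (δ₂ ^ (2 * a + b) * n ^ (1 - (2 * a + b)))) := by
    rw [Real.div_rpow hn0.le hδ₂.le, Real.rpow_sub hn0, Real.rpow_one,
      show √d * Kx * (√d * Kx * Ky) = √d * √d * (Kx ^ 2 * Ky) by ring, hsd]
    have : 0 < n ^ (2 * a + b) := by positivity
    have : 0 < δ₂ ^ (2 * a + b) := by positivity
    field_simp
  have hnℓ : (n / ℓ) ^ a * ℓ ^ a = n ^ a := by
    rw [← Real.mul_rpow (by positivity) hℓ0.le, div_mul_cancel₀ _ hℓ0.ne']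
  have e0 : 4 / n * (C * (√d * Kx * Ky * (n ^ (1 / 2 : ℝ) + (n / ℓ) ^ a * ℓ ^ (a + b)))) * Kx * ℓ ^ a
      = 4 * C * Kx ^ 2 * Ky * (√d * (n ^ (1 / 2 : ℝ) / n * ℓ ^ a))
        + 4 * C * Kx ^ 2 * Ky * (√d * (n ^ a / n * ℓ ^ (a + b))) := by
    rw [← hnℓ]; ring
  rw [e0, t3, mul_add, mul_add]
  have h1 : √d * (n ^ (1 / 2 : ℝ) / n * ℓ ^ a) ≤
      2 * (√d * (n ^ (1 / 2 : ℝ) / n * (n ^ a / δ₁ ^ a))) := by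
    have : √d * (n ^ (1 / 2 : ℝ) / n * ℓ ^ a) ≤
        √d * (n ^ (1 / 2 : ℝ) / n * (2 * (n ^ a / δ₁ ^ a))) := by
      gcongr; exact hℓle a ha0.le (by linarith)
    linarith
  have h2 : √d * (n ^ a / n * ℓ ^ (a + b)) ≤
      2 * (√d * (n ^ a / n * (n ^ (a + b) / δ₁ ^ (a + b)))) := by
    have : √d * (n ^ a / n * ℓ ^ (a + b)) ≤
        √d * (n ^ a / n * (2 * (n ^ (a + b) / δ₁ ^ (a + b)))) := by
      gcongr; exact hℓle (a + b) (by linarith) (by linarith)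
    linarith
  have hpos : 0 < 4 * C * Kx ^ 2 * Ky := by positivity
  have s1 := mul_le_mul_of_nonneg_left (h1.trans (mul_le_mul_of_nonneg_left t1 zero_le_two)) hpos.le
  have s2 := mul_le_mul_of_nonneg_left (h2.trans (mul_le_mul_of_nonneg_left t2 zero_le_two)) hpos.le
  have s3 : 4 * Kx ^ 2 * Ky * (d / (δ₂ ^ (2 * a + b) * n ^ (1 - (2 * a + b)))) ≤
      8 * C * Kx ^ 2 * Ky * (d / (δ₂ ^ (2 * a + b) * n ^ (1 - (2 * a + b)))) := by
    gcongr; linarith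
  linarith

theorem rate_nonneg (n d : ℕ) (qx q : ℝ) {δ₁ δ₂ : ℝ} (hδ₁ : 0 < δ₁) (hδ₂ : 0 < δ₂) :
    0 ≤ rate n d qx q δ₁ δ₂ := by
  unfold rate; positivity

end LinReg

/-! ### The bound for least squares estimators -/

theorem theoremA1 (qx q Kx Ky lo : ℝ) (hqx : 4 ≤ qx) (hq : 2 ≤ q)
    (hs : 2 < (1 / qx + 1 / q)⁻¹) (hKx : 1 ≤ Kx) (hKy : 0 < Ky) (hlo : 0 < lo) :
    ∃ C : ℝ, 0 < C ∧
      ∀ (n d : ℕ) (P : Measure ((Fin d → ℝ) × ℝ)) (β : Fin d → ℝ) (hi : ℝ),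
        LinReg.IsRegressionLaw P →
        LinReg.IsProjectionParameter P β →
        LinReg.ErrorMoment P β q Ky →
        LinReg.CovariateMoment P qx Kx →
        lo ≤ hi → LinReg.ScoreEigenvalueBounds P β lo hi →
        ∀ {Ω : Type*} [MeasurableSpace Ω] (μ : Measure Ω) [IsProbabilityMeasure μ]
          (X : Fin n → Ω → Fin d → ℝ) (Y : Fin n → Ω → ℝ) (βhat : Ω → Fin d → ℝ),
          iIndepFun (fun i ω => (X i ω, Y i ω)) μ →
          (∀ i, HasLaw (fun ω => (X i ω, Y i ω)) P μ) →
          (∀ᵐ ω ∂μ, LinReg.IsLeastSquares (fun i => X i ω) (fun i => Y i ω) (βhat ω)) →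
          ∀ δ₀ δ₁ δ₂ : ℝ, 0 < δ₀ → 0 < δ₁ → 0 < δ₂ →
            0 < LinReg.gramFactor n d Kx δ₀ →
            μ {ω | ¬ ∀ i, |X i ω ⬝ᵥ (βhat ω - β)| ≤
                C * (LinReg.gramFactor n d Kx δ₀)⁻¹ * LinReg.rate n d qx q δ₁ δ₂} ≤
              ENNReal.ofReal (δ₀ + δ₁ + δ₂) := by
  obtain ⟨C, hC, hmain⟩ := LinReg.exists_measure_fitted_le hqx
  refine ⟨8 * C * Kx ^ 2 * Ky, by positivity, ?_⟩
  intro n d P β hi hP hβ herr hcov _ _ Ω _ μ _ X Y βhat hindep hlaw hls δ₀ δ₁ δ₂ hδ₀ hδ₁ hδ₂ hg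
  have := hP.isProbabilityMeasure
  -- Otherwise each budget is below 1, as the estimates with logarithms and powers of `δ₀` and `δ₁`
  -- require.
  by_cases hsum : 1 ≤ δ₀ + δ₁ + δ₂
  · refine prob_le_one.trans ?_
    rw [← ENNReal.ofReal_one]
    exact ENNReal.ofReal_le_ofReal hsum
  push Not at hsum
  have hrate := LinReg.rate_nonneg n d qx q hδ₁ hδ₂
  have hbound0 : 0 ≤ 8 * C * Kx ^ 2 * Ky * (LinReg.gramFactor n d Kx δ₀)⁻¹ *
      LinReg.rate n d qx q δ₁ δ₂ := by positivity
  rcases Nat.eq_zero_or_pos d with rfl | hd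
  · refine le_of_eq_of_le ?_ zero_le
    refine measure_mono_null (t := ∅) (fun ω hω => hω fun i => ?_) measure_empty
    simpa [dotProduct] using hbound0
  obtain _ | N := n
  · refine le_of_eq_of_le ?_ zero_le
    exact measure_mono_null (t := ∅) (fun ω hω => hω fun i => i.elim0) measure_empty
  have hmodel := LinReg.whitenedModel hqx hq (by linarith) hKy.le hP hβ herr hcov
  have hs' : 2 ≤ LinReg.harm qx q 1 1 := hs.le
  have hN := LinReg.sample_size_of_gramFactor_pos hd hKx hδ₀ (by linarith) hg
  have hB := hmain hd hmodel (by linarith) hs' hKx hKy hδ₀ (by linarith) hδ₁ (by linarith) hδ₂ hN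
  have hcmp := LinReg.bound_le_rate (N := N) (d := d) hqx hq hKx hKy hC hδ₁ (by linarith) hδ₂
  -- Positivity of the factor has already supplied the sample size condition; its inverse only
  -- enlarges the bound.
  have hg1 : 1 ≤ (LinReg.gramFactor (N + 1) d Kx δ₀)⁻¹ := by
    refine (one_le_inv₀ hg).2 ?_
    unfold LinReg.gramFactor
    have : 0 ≤ 9 * Kx ^ 2 * √((d + 2 * Real.log (2 * (N + 1 : ℕ) / δ₀)) / (N + 1 : ℕ)) := by
      positivity
    linarith
  have hgr : 8 * C * Kx ^ 2 * Ky * LinReg.rate (N + 1) d qx q δ₁ δ₂ ≤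
      8 * C * Kx ^ 2 * Ky * (LinReg.gramFactor (N + 1) d Kx δ₀)⁻¹ *
        LinReg.rate (N + 1) d qx q δ₁ δ₂ := by
    exact mul_le_mul_of_nonneg_right (le_mul_of_one_le_right (by positivity) hg1) hrate
  have hmeas : ∀ i, AEMeasurable (fun ω => (X i ω, Y i ω)) μ := fun i => (hlaw i).aemeasurable
  have hjoint : AEMeasurable (fun ω i => (X i ω, Y i ω)) μ := aemeasurable_pi_lambda _ hmeas
  have hmap : μ.map (fun ω i => (X i ω, Y i ω)) = Measure.pi fun _ : Fin (N + 1) => P := by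
    rw [iIndepFun.map_fun_eq_pi_map hmeas hindep]
    simp_rw [fun i => (hlaw i).map_eq]
  rw [← hmap] at hB
  -- The exceptional event on the sample concerns all solutions of the normal equations at once, so
  -- neither measurability of `βhat` nor that of the event is needed.
  refine le_trans (measure_mono_ae ?_) ((Measure.le_map_apply hjoint _).trans hB)
  filter_upwards [hls] with ω hω hbad hgood
  refine hbad fun i => ?_
  have h1 := hgood _ (LinReg.IsLeastSquares.whitened_normal hP
    (z := fun i => (X i ω, Y i ω)) hω β) i
  rw [hP.whitened_dotProduct_sqrt] at h1
  exact h1.trans (hcmp.trans hgr)
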